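/- Let $k$ be a local field, i.e. a complete non-Archimedean valued field whose value group $|k^\times|$ is infinite cyclic and whose residue field $\overline{k}$ is finite. Let $\mathcal{A}$ be a non-zero (unital, associative, not necessarily commutative) Banach $k$-algebra with non-Archimedean submultiplicative norm, $\|1\|=1$, and $\|\mathcal{A}\|\subset|k|$. For $A\in\mathcal{A}$ let $\sigma_{\mathcal{A}}(A)=\{\lambda\in k : A-\lambda\notin\mathcal{A}^\times\}$, a compact subset of $k$. Write $\overline{\mathcal{A}}=\{\|B\|\le 1\}/\{\|B\|<1\}$ for the normal reduction, a $\overline{k}$-algebra, and $\overline{B}$ for the class of $B$ when $\|B\|\le 1$. We say that $A$ admits the continuous functional calculus in $\mathcal{A}$ if there is an isometric $k$-algebra homomorphism $C(\sigma_{\mathcal{A}}(A),k)\to\mathcal{A}$ (for the supremum norm) sending the coordinate function $z$ to $A$. An element $B\in\mathcal{A}$ is naive of level $0$ at $0$ if either $B=0$, or the following hold, where $a$ denotes an element of $k^\times$ with $|a|=\|B\|$: (1) $\sigma_{\overline{\mathcal{A}}}(\overline{a^{-1}B})\subset\overline{k}$ is finite; (2) there is an injective $\overline{k}$-algebra homomorphism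 $\iota\colon\overline{k}^{\,\sigma_{\overline{\mathcal{A}}}(\overline{a^{-1}B})}\to\overline{\mathcal{A}}$ sending the coordinate function to $\overline{a^{-1}B}$; (3) for every such $a$, the map $\sigma_{\mathcal{A}}(a^{-1}B)\to\sigma_{\overline{\mathcal{A}}}(\overline{a^{-1}B})$ induced by reduction is surjective. (Conditions (1) and (2) do not depend on the choice of $a$.) For such $B\neq 0$ let $P(B)$ be the unique idempotent of norm at most $1$ in the closure of $k[B]$ with $\overline{P(B)}=\iota(1_{\{0\}})$, where $1_{\{0\}}$ is the characteristic function of $\{0\}$ (the zero function if $0$ is not in the spectrum); put $P(0)=0$, and $r(B)=P(B)B$. Inductively, $B$ is naive of level $i+1$ at $0$ if it is naive of level $0$ at $0$ and $r(B)$ is naive of level $i$ at $0$. An element $A\in\mathcal{A}$ is naive if $A-\lambda$ is naive of level $i$ at $0$ for all $\lambda\in\sigma_{\mathcal{A}}(A)$ and all $i\in\mathbb{N}$. Theorem. An element $A\in\mathcal{A}$ admits the continuous functional calculus in $\mathcal{A}$ if and only if $\sigma_{\mathcal{A}}(A)\neq\emptyset$ and $A$ is naive. -/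

import Mathlib

namespace NaiveCalculus

section Reduction

variable (R : Type*) [NormedRing R] [NormOneClass R] [IsUltrametricDist R]

/-- The closed unit ball `R(1)` of a non-Archimedean normed ring, as a subring. -/
def unitBall : Subring R where
  carrier := {x | ‖x‖ ≤ 1}
  mul_mem' := fun {a b} ha hb =>
    (norm_mul_le a b).trans (mul_le_one₀ ha (norm_nonneg b) hb)
  one_mem' := (norm_one (α := R)).le
  add_mem' := fun {a b} ha hb =>
    (IsUltrametricDist.norm_add_le_max a b).trans (max_le ha hb)
  zero_mem' := by simp
  neg_mem' := fun {a} ha => by simpa using ha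

/-- The open unit ball `R(1-)`, as an ideal of the closed unit ball. -/
def openUnitIdeal : Ideal (unitBall R) where
  carrier := {x | ‖(x : R)‖ < 1}
  add_mem' := fun {a b} ha hb =>
    (IsUltrametricDist.norm_add_le_max (a : R) (b : R)).trans_lt (max_lt ha hb)
  zero_mem' := by simp
  smul_mem' := fun c x hx =>
    (norm_mul_le (c : R) (x : R)).trans_lt
      (mul_lt_one_of_nonneg_of_lt_one_right c.2 (norm_nonneg _) hx)

instance : (openUnitIdeal R).IsTwoSided where
  mul_mem_of_left := fun {a} b ha =>
    (norm_mul_le (a : R) (b : R)).trans_lt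
      (mul_lt_one_of_nonneg_of_lt_one_left (norm_nonneg _) ha b.2)

/-- The normal reduction `R(1)/R(1-)` of a non-Archimedean normed ring. For a valued field it is
the residue field. -/
abbrev NormalReduction : Type _ := unitBall R ⧸ openUnitIdeal R

variable {R} in
/-- The normal reduction of an element of norm at most one. -/
def reduce (x : R) (hx : ‖x‖ ≤ 1) : NormalReduction R :=
  Ideal.Quotient.mk (openUnitIdeal R) ⟨x, hx⟩

end Reduction

/-- A (non-Archimedean) local field: a complete valued field whose value group is infinite cyclic
and whose residue field is finite. -/
class IsLocalField (k : Type*) [NormedField k] [IsUltrametricDist k] : Prop where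
  complete : CompleteSpace k
  discrete : ∃ π : k, 0 < ‖π‖ ∧ ‖π‖ < 1 ∧ ∀ x : k, x ≠ 0 → ∃ n : ℤ, ‖x‖ = ‖π‖ ^ n
  finite_residue : Finite (NormalReduction k)

section ProperSpace

variable (k : Type*) [NormedField k] [IsUltrametricDist k] [IsLocalField k]

theorem exists_finite_cover (π : k) (hπ0 : 0 < ‖π‖) (hπ1 : ‖π‖ < 1)
    (hπ : ∀ x : k, x ≠ 0 → ∃ n : ℤ, ‖x‖ = ‖π‖ ^ n) (n : ℕ) :
    ∃ t : Set k, t.Finite ∧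
      Metric.closedBall (0 : k) 1 ⊆ ⋃ y ∈ t, Metric.closedBall y (‖π‖ ^ n) := by
  have hπne : π ≠ 0 := norm_pos_iff.mp hπ0
  have hdisc : ∀ x : k, ‖x‖ < 1 → ‖x‖ ≤ ‖π‖ := by
    intro x hx
    rcases eq_or_ne x 0 with rfl | h0
    · simp
    · obtain ⟨m, hm⟩ := hπ x h0
      have h1 : 0 < m := by
        by_contra hcon
        have := one_le_zpow_of_nonpos₀ hπ0 hπ1.le (not_lt.mp hcon)
        linarith
      calc ‖x‖ = ‖π‖ ^ m := hm
        _ ≤ ‖π‖ ^ (1 : ℤ) := zpow_le_zpow_right_of_le_one₀ hπ0 hπ1.le (by omega)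
        _ = ‖π‖ := zpow_one _
  have := IsLocalField.finite_residue (k := k)
  induction n with
  | zero => exact ⟨{0}, Set.finite_singleton _, by simp⟩
  | succ n ih =>
    obtain ⟨t, ht, hcov⟩ := ih
    let s : Set k := Set.range fun r : NormalReduction k => ((Quotient.out r : unitBall k) : k)
    have hs : s.Finite := Set.finite_range _
    refine ⟨Set.image2 (fun a b => a + π * b) s t, hs.image2 _ ht, fun x hx => ?_⟩
    have hx1 : ‖x‖ ≤ 1 := by simpa using hx
    let u : unitBall k := ⟨x, hx1⟩
    let r : NormalReduction k := Ideal.Quotient.mk (openUnitIdeal k) u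
    have hmem : u - Quotient.out r ∈ openUnitIdeal k := by
      rw [← Ideal.Quotient.eq]
      exact (Ideal.Quotient.mk_out r).symm
    have hlt : ‖x - ((Quotient.out r : unitBall k) : k)‖ ≤ ‖π‖ := hdisc _ hmem
    set a : k := ((Quotient.out r : unitBall k) : k) with ha
    have hy : (x - a) / π ∈ Metric.closedBall (0 : k) 1 := by
      simp only [mem_closedBall_zero_iff, norm_div]
      exact (div_le_one hπ0).mpr hlt
    obtain ⟨b, hb, hb'⟩ := Set.mem_iUnion₂.mp (hcov hy)
    refine Set.mem_iUnion₂.mpr ⟨a + π * b, ⟨a, ⟨r, rfl⟩, b, hb, rfl⟩, ?_⟩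
    rw [mem_closedBall_iff_norm] at hb' ⊢
    have : x - (a + π * b) = π * ((x - a) / π - b) := by
      field_simp
      ring
    rw [this, norm_mul, pow_succ']
    gcongr

/-- A local field is a proper metric space, so spectra over it are compact. -/
instance : ProperSpace k := by
  have := IsLocalField.complete (k := k)
  obtain ⟨π, hπ0, hπ1, hπ⟩ := IsLocalField.discrete (k := k)
  have hπne : π ≠ 0 := norm_pos_iff.mp hπ0
  have h1 : IsCompact (Metric.closedBall (0 : k) 1) := by
    refine TotallyBounded.isCompact_of_isClosed ?_ Metric.isClosed_closedBall
    refine Metric.totallyBounded_iff.mpr fun ε hε => ?_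
    obtain ⟨n, hn⟩ := exists_pow_lt_of_lt_one hε hπ1
    obtain ⟨t, ht, hcov⟩ := exists_finite_cover k π hπ0 hπ1 hπ n
    exact ⟨t, ht, hcov.trans (Set.iUnion₂_mono fun y _ => Metric.closedBall_subset_ball hn)⟩
  refine ⟨fun x r => ?_⟩
  obtain ⟨n, hn⟩ := pow_unbounded_of_one_lt r (one_lt_inv₀ hπ0 |>.mpr hπ1)
  have h2 : IsCompact ((fun y : k => x + π⁻¹ ^ n * y) '' Metric.closedBall (0 : k) 1) :=
    h1.image (by fun_prop)
  refine h2.of_isClosed_subset Metric.isClosed_closedBall fun y hy => ?_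
  refine ⟨π ^ n * (y - x), ?_, ?_⟩
  · rw [mem_closedBall_iff_norm] at hy
    have h3 : ‖y - x‖ ≤ ‖π‖⁻¹ ^ n := hy.trans hn.le
    rw [mem_closedBall_zero_iff, norm_mul, norm_pow]
    calc ‖π‖ ^ n * ‖y - x‖ ≤ ‖π‖ ^ n * ‖π‖⁻¹ ^ n := by gcongr
      _ = 1 := by rw [← mul_pow, mul_inv_cancel₀ hπ0.ne', one_pow]
  · have : π⁻¹ ^ n * π ^ n = 1 := by rw [← mul_pow, inv_mul_cancel₀ hπne, one_pow]
    change x + π⁻¹ ^ n * (π ^ n * (y - x)) = y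
    rw [← mul_assoc, this]
    ring

end ProperSpace

section Algebra

variable (k : Type*) [NormedField k] [IsUltrametricDist k]
  {A : Type*} [NormedRing A] [NormOneClass A] [IsUltrametricDist A] [NormedAlgebra k A]

variable (A) in
/-- The structure map `k(1) → A(1)`. -/
def unitBallMap : unitBall k →+* unitBall A :=
  ((algebraMap k A).comp (unitBall k).subtype).codRestrict (unitBall A) fun x => by
    have h : ‖(x : k)‖ ≤ 1 := x.2
    change ‖algebraMap k A (x : k)‖ ≤ 1
    rwa [norm_algebraMap']

/-- The normal reduction of a Banach `k`-algebra is an algebra over the residue field of `k`, with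
structure map induced by `k(1) → A(1)`. -/
instance (priority := 100) : Algebra (NormalReduction k) (NormalReduction A) :=
  RingHom.toAlgebra'
    (Ideal.Quotient.lift (openUnitIdeal k)
      ((Ideal.Quotient.mk (openUnitIdeal A)).comp (unitBallMap k A)) fun a ha => by
        refine Ideal.Quotient.eq_zero_iff_mem.mpr ?_
        change ‖algebraMap k A (a : k)‖ < 1
        rw [norm_algebraMap']
        exact ha)
    (by
      intro c x
      obtain ⟨c, rfl⟩ := Ideal.Quotient.mk_surjective c
      obtain ⟨x, rfl⟩ := Ideal.Quotient.mk_surjective x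
      rw [Ideal.Quotient.lift_mk, RingHom.comp_apply, ← map_mul, ← map_mul]
      congr 1
      exact Subtype.ext (Algebra.commutes (c : k) (x : A)))

/-- A continuous functional calculus of `a` in `A`: an isometric `k`-algebra homomorphism
`C(σ_A(a), k) → A`, for the supremum norm, that sends the coordinate function to `a`. -/
def HasContinuousCalculus [CompleteSpace A] [IsLocalField k] (a : A) : Prop :=
  ∃ ι : C(spectrum k a, k) →ₐ[k] A,
    (∀ f, ‖ι f‖ = ‖f‖) ∧ ι ⟨fun z => (z : k), continuous_subtype_val⟩ = a

/-- `ι` is the continuous functional calculus of an element `x` of a normal reduction with finite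
spectrum. Everything carries the trivial norm here, so that every function on the spectrum is
continuous and isometric means injective. -/
def IsReductiveCalculus (x : NormalReduction A)
    (ι : (spectrum (NormalReduction k) x → NormalReduction k) →ₐ[NormalReduction k]
      NormalReduction A) : Prop :=
  Function.Injective ι ∧ ι (fun Λ => (Λ : NormalReduction k)) = x

/-- `c ∈ k` is a nonzero scalar with `|c| = ‖a‖`. -/
def IsScale (a : A) (c : k) : Prop := c ≠ 0 ∧ ‖c‖ = ‖a‖

set_option linter.unusedSectionVars false in
variable {k} in
theorem IsScale.norm_inv_smul_le {a : A} {c : k} (h : IsScale k a c) : ‖c⁻¹ • a‖ ≤ 1 := by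
  rw [norm_smul, norm_inv, h.2, ← h.2, inv_mul_cancel₀ (norm_ne_zero_iff.mpr h.1)]

variable {k} in
/-- The normal reduction of `c⁻¹ a` for a scalar `c` with `|c| = ‖a‖`. -/
def scaledReduction {a : A} {c : k} (h : IsScale k a c) : NormalReduction A :=
  reduce (c⁻¹ • a) h.norm_inv_smul_le

/-- `a` is reductively finite. -/
def IsReductivelyFinite (a : A) : Prop :=
  ∃ (c : k) (h : IsScale k a c), (spectrum (NormalReduction k) (scaledReduction h)).Finite

/-- `a` admits the reductive (continuous) functional calculus. -/
def HasReductiveCalculus (a : A) : Prop :=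
  ∃ (c : k) (h : IsScale k a c), ∃ ι, IsReductiveCalculus k (scaledReduction h) ι

/-- The projection `σ_A(c⁻¹ a) → σ(reduction of c⁻¹ a)` is surjective for every scalar `c`
with `|c| = ‖a‖`. -/
def SpectrumLifts (a : A) : Prop :=
  ∀ (c : k) (h : IsScale k a c), ∀ Λ ∈ spectrum (NormalReduction k) (scaledReduction h),
    ∃ μ ∈ spectrum k (c⁻¹ • a), ∃ hμ : ‖μ‖ ≤ 1, reduce μ hμ = Λ

/-- Naive of level `0` at `0`. -/
def IsNaiveZero (a : A) : Prop :=
  a = 0 ∨ (IsReductivelyFinite k a ∧ HasReductiveCalculus k a ∧ SpectrumLifts k a)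

open Classical in
/-- `p` is the idempotent in the closed subalgebra generated by `a` that lifts the image, under the
reductive calculus, of the characteristic function of `{0}`. -/
def IsLiftedProjection (a p : A) : Prop :=
  IsIdempotentElem p ∧ p ∈ (Algebra.adjoin k {a}).topologicalClosure ∧
    ∃ (hp : ‖p‖ ≤ 1) (c : k) (h : IsScale k a c), ∃ ι,
      IsReductiveCalculus k (scaledReduction h) ι ∧
        reduce p hp = ι (fun Λ => if (Λ : NormalReduction k) = 0 then 1 else 0)

open Classical in
/-- The projection attached to an element that is naive of level `0` at `0`: it is `0` for `a = 0`,
and the lifted projection otherwise. (The value on other elements is irrelevant.) -/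
noncomputable def projection (a : A) : A :=
  if h : a ≠ 0 ∧ ∃ p, IsLiftedProjection k a p then h.2.choose else 0

/-- One step of the process: multiply by the lifted projection. -/
noncomputable def step (a : A) : A := projection k a * a

/-- Naive of level `i` at `0`. -/
def IsNaiveLevel : ℕ → A → Prop
  | 0, a => IsNaiveZero k a
  | i + 1, a => IsNaiveZero k a ∧ IsNaiveLevel i (step k a)

/-- `a` is naive: at every point of its spectrum it is naive of every level. -/
def IsNaive (a : A) : Prop :=
  ∀ μ ∈ spectrum k a, ∀ i : ℕ, IsNaiveLevel k i (a - algebraMap k A μ)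

end Algebra

end NaiveCalculus

open Filter Topology

namespace NaiveCalculus

/-! ### Ultrametric estimates and lifting of idempotents. -/

section Reduction

variable {R : Type*} [NormedRing R] [IsUltrametricDist R]

/-! Calculus implies naive: an isometric `ι : C(X, k) → A` embeds the reduction of `C(X, k)`, that
is, the locally constant functions from `X` to the residue field, into the reduction of `A`. There
the spectrum of a reduced element is the set of values of the function, so every `ι f` is naive of
level 0. The range of `ι` is closed, so it contains the lifted projection of `ι f`; one step stays
in the range, and induction gives all levels.

Naive implies calculus: polynomials are dense in the continuous functions on the spectrum, so it
suffices that `‖p(a)‖` is the supremum of `|p|` on the spectrum. The bound `≥` is spectral mapping.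
For `≤`, iterating the step at each spectral point `t` gives idempotents `e t` in the closure of
`k[a]` with `‖e t * (a - t)‖ ≤ ‖C * π ^ n‖` and `a - t` bounded below on the complement. Then `e t *
p(a)` differs from `p(t) * e t` by at most a constant times `‖C * π ^ n‖`, and `n → ∞` finishes,
provided the `e t` cover: a common bound on all `e t * u` must bound `u`. This is the crux
(`IsSpectralProjection.norm_mul_le_of_refinement`), and it is where surjectivity onto the reduced
spectrum enters: each reduced spectral value comes from a genuine point of the spectrum, so no piece
of the reduction is missed.

Throughout, if `N` is the order of the residue unit group, then `1 - z ^ N` is the indicator of `0`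
on the residue field, and Newton's iteration lifts it to an idempotent. -/

theorem norm_sub_le_max' (x y : R) : ‖x - y‖ ≤ max ‖x‖ ‖y‖ := by
  simpa [sub_eq_add_neg] using IsUltrametricDist.norm_add_le_max x (-y)

theorem norm_le_of_norm_sub_le {x y : R} {K : ℝ} (h : ‖x - y‖ ≤ K) (hy : ‖y‖ ≤ K) : ‖x‖ ≤ K := by
  have := IsUltrametricDist.norm_add_le_max (x - y) y
  rw [sub_add_cancel] at this
  exact this.trans (max_le h hy)

theorem norm_lt_of_norm_sub_lt {x y : R} {K : ℝ} (h : ‖x - y‖ < K) (hy : ‖y‖ < K) : ‖x‖ < K := by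
  have := IsUltrametricDist.norm_add_le_max (x - y) y
  rw [sub_add_cancel] at this
  exact this.trans_lt (max_lt h hy)

variable [NormOneClass R]

theorem mk_eq_mk_iff {x y : unitBall R} :
    Ideal.Quotient.mk (openUnitIdeal R) x = Ideal.Quotient.mk (openUnitIdeal R) y ↔
      ‖(x : R) - (y : R)‖ < 1 := by
  rw [Ideal.Quotient.eq]
  rfl

theorem mk_eq_zero_iff {x : unitBall R} :
    Ideal.Quotient.mk (openUnitIdeal R) x = 0 ↔ ‖(x : R)‖ < 1 := by
  rw [Ideal.Quotient.eq_zero_iff_mem]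
  rfl

/-- An idempotent modulo the open unit ball lifts to an idempotent, by Newton's iteration. -/
theorem exists_isIdempotentElem_norm_sub_lt [CompleteSpace R] {f : R} (hf : ‖f‖ ≤ 1)
    (hff : ‖f * f - f‖ < 1) :
    ∃ e : R, IsIdempotentElem e ∧ ‖e - f‖ < 1 ∧
      ∀ S : Subring R, IsClosed (S : Set R) → f ∈ S → e ∈ S := by
  -- Newton's map `3u² - 2u³` for `u² = u`: since `(2u - 1)² = 1 + 4(u² - u)`, the derivative is its
  -- own approximate inverse and no division is needed, even in residue characteristic 2. A defect
  -- `d` becomes `(4d - 3)d²`.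
  let φ : R → R := fun u => u - (2 * u - 1) * (u * u - u)
  let u : ℕ → R := fun n => φ^[n] f
  set δ := ‖f * f - f‖ with hδ
  have hδ0 : 0 ≤ δ := norm_nonneg _
  have husucc : ∀ n, u (n + 1) = φ (u n) := fun n => Function.iterate_succ_apply' φ n f
  have key : ∀ n, ‖u n‖ ≤ 1 ∧ ‖u n * u n - u n‖ ≤ δ ^ (n + 1) ∧ ‖u n - f‖ ≤ δ := by
    intro n
    induction n with
    | zero => exact ⟨hf, by simp [u, hδ], by simp [u, hδ0]⟩
    | succ n ih =>
      obtain ⟨h1, h2, h3⟩ := ih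
      set v := u n with hv
      set d := v * v - v with hd
      have hdδ : ‖d‖ ≤ δ := h2.trans (pow_le_of_le_one hδ0 hff.le (by omega))
      have hd1 : ‖d‖ ≤ 1 := hdδ.trans hff.le
      have hvm : v ∈ unitBall R := h1
      have hdm : d ∈ unitBall R := hd1
      have hc : 2 * v - 1 ∈ unitBall R := by
        rw [two_mul]
        exact sub_mem (add_mem hvm hvm) (one_mem _)
      have hs : ‖(2 * v - 1) * d‖ ≤ ‖d‖ :=
        (norm_mul_le _ _).trans (mul_le_of_le_one_left (norm_nonneg _) hc)
      have e1 : φ v = v - (2 * v - 1) * d := rfl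
      have e2 : φ v * φ v - φ v = (d + d + d + d - 1 - 1 - 1) * (d * d) := by
        rw [e1, hd]
        noncomm_ring
      have hq : d + d + d + d - 1 - 1 - 1 ∈ unitBall R :=
        sub_mem (sub_mem (sub_mem (add_mem (add_mem (add_mem hdm hdm) hdm) hdm)
          (one_mem _)) (one_mem _)) (one_mem _)
      rw [husucc, ← hv]
      refine ⟨?_, ?_, ?_⟩
      · rw [e1]
        exact (norm_sub_le_max' _ _).trans (max_le h1 (hs.trans hd1))
      · rw [e2]
        calc _ ≤ ‖d + d + d + d - 1 - 1 - 1‖ * ‖d * d‖ := norm_mul_le _ _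
          _ ≤ 1 * (‖d‖ * ‖d‖) := by
            gcongr
            · exact hq
            · exact norm_mul_le _ _
          _ ≤ 1 * (δ ^ (n + 1) * δ) := by gcongr
          _ = δ ^ (n + 1 + 1) := by ring
      · refine norm_le_of_norm_sub_le (y := v - f) ?_ h3
        rw [e1, show v - (2 * v - 1) * d - f - (v - f) = -((2 * v - 1) * d) by abel, norm_neg]
        exact hs.trans hdδ
  have hcau : CauchySeq u := by
    refine cauchySeq_of_le_geometric δ δ hff fun n => ?_
    obtain ⟨h1, h2, -⟩ := key n
    have hvm : u n ∈ unitBall R := h1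
    have hc : 2 * u n - 1 ∈ unitBall R := by
      rw [two_mul]
      exact sub_mem (add_mem hvm hvm) (one_mem _)
    rw [husucc, dist_eq_norm, show u n - φ (u n) = (2 * u n - 1) * (u n * u n - u n) by
      simp only [φ]; abel]
    calc _ ≤ _ := norm_mul_le _ _
      _ ≤ 1 * δ ^ (n + 1) := by
        gcongr
        exact hc
      _ = δ * δ ^ n := by ring
  obtain ⟨e, he⟩ := cauchySeq_tendsto_of_complete hcau
  refine ⟨e, ?_, ?_, fun S hSc hS => ?_⟩
  · have h1 : Tendsto (fun n => u n * u n - u n) atTop (𝓝 (e * e - e)) := (he.mul he).sub he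
    have h2 : Tendsto (fun n => u n * u n - u n) atTop (𝓝 0) := by
      refine squeeze_zero_norm (fun n => (key n).2.1) ?_
      exact (tendsto_pow_atTop_nhds_zero_of_lt_one hδ0 hff).comp (tendsto_add_atTop_nat 1)
    exact sub_eq_zero.mp (tendsto_nhds_unique h1 h2)
  · exact (le_of_tendsto (he.sub_const f).norm (Eventually.of_forall fun n => (key n).2.2)).trans_lt
      hff
  · refine hSc.mem_of_tendsto he (Eventually.of_forall fun n => ?_)
    induction n with
    | zero => exact hS
    | succ n ih =>
      have ih : u n ∈ S := ih
      change u (n + 1) ∈ S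
      rw [husucc]
      exact sub_mem ih (mul_mem (sub_mem (mul_mem (ofNat_mem S 2) ih) (one_mem _))
        (sub_mem (mul_mem ih ih) ih))

end Reduction

/-! ### The residue field and the uniformizer. -/

section LocalField

variable (k : Type*) [NormedField k] [IsUltrametricDist k]

theorem isUnit_of_ne_zero {L : NormalReduction k} (hL : L ≠ 0) : IsUnit L := by
  obtain ⟨x, rfl⟩ := Ideal.Quotient.mk_surjective L
  have hx : ‖(x : k)‖ = 1 :=
    le_antisymm x.2 (not_lt.mp fun h => hL (mk_eq_zero_iff.mpr h))
  have hx0 : (x : k) ≠ 0 := by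
    intro h
    simp [h] at hx
  refine IsUnit.map _ ?_
  refine IsUnit.of_mul_eq_one (⟨(x : k)⁻¹, ?_⟩ : unitBall k) (Subtype.ext (mul_inv_cancel₀ hx0))
  change ‖(x : k)⁻¹‖ ≤ 1
  rw [norm_inv, hx, inv_one]

variable {k} in
theorem norm_sub_pow_lt_one {N : ℕ} (hN : ∀ L : NormalReduction k, L ≠ 0 → L ^ N = 1) {x : k}
    (hx : ‖x‖ = 1) : ‖1 - x ^ N‖ < 1 := by
  have h := hN (Ideal.Quotient.mk (openUnitIdeal k) ⟨x, hx.le⟩)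
    (fun h => by simpa [hx] using mk_eq_zero_iff.mp h)
  rw [← map_pow, ← map_one (Ideal.Quotient.mk (openUnitIdeal k)), mk_eq_mk_iff] at h
  rw [norm_sub_rev]
  exact h

variable [IsLocalField k]

/-- There is a uniformizer. -/
theorem exists_uniformizer :
    ∃ π : k, 0 < ‖π‖ ∧ ‖π‖ < 1 ∧ ∀ x : k, ‖x‖ < 1 → ‖x‖ ≤ ‖π‖ := by
  obtain ⟨π, h0, h1, hπ⟩ := IsLocalField.discrete (k := k)
  refine ⟨π, h0, h1, fun x hx => ?_⟩
  rcases eq_or_ne x 0 with rfl | hx0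
  · simp
  obtain ⟨m, hm⟩ := hπ x hx0
  have hm1 : 0 < m := by
    by_contra hcon
    have := one_le_zpow_of_nonpos₀ h0 h1.le (not_lt.mp hcon)
    linarith
  calc ‖x‖ = ‖π‖ ^ m := hm
    _ ≤ ‖π‖ ^ (1 : ℤ) := zpow_le_zpow_right_of_le_one₀ h0 h1.le (by omega)
    _ = ‖π‖ := zpow_one _

instance : Nontrivial (NormalReduction k) :=
  ⟨0, 1, fun h => by
    have : ‖((1 : unitBall k) : k)‖ < 1 := mk_eq_zero_iff.mp (h.symm)
    simp at this⟩

/-- Lagrange's theorem in the finite residue unit group. It makes the indicator of `0` on the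
residue field a polynomial. -/
theorem exists_pow_eq_one :
    ∃ N : ℕ, N ≠ 0 ∧ ∀ L : NormalReduction k, L ≠ 0 → L ^ N = 1 := by
  have := IsLocalField.finite_residue (k := k)
  refine ⟨Nat.card (NormalReduction k)ˣ, Nat.card_pos.ne', fun L hL => ?_⟩
  obtain ⟨u, rfl⟩ := isUnit_of_ne_zero k hL
  rw [← Units.val_pow_eq_pow_val, pow_card_eq_one', Units.val_one]

end LocalField

/-! ### Non-Archimedean Weierstrass approximation. -/

section Density

variable {k : Type*} [NormedField k] [IsUltrametricDist k] [IsLocalField k]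

theorem exists_norm_le_norm (r : ℝ) : ∃ C : k, C ≠ 0 ∧ r ≤ ‖C‖ := by
  obtain ⟨π, h0, h1, -⟩ := exists_uniformizer k
  obtain ⟨n, hn⟩ := pow_unbounded_of_one_lt r ((one_lt_inv₀ h0).mpr h1)
  exact ⟨π⁻¹ ^ n, pow_ne_zero _ (inv_ne_zero (norm_pos_iff.mp h0)), by
    rw [norm_pow, norm_inv]
    exact hn.le⟩

/-- The indicator function of a ball in a compact set is a limit of polynomials. -/
theorem exists_indicator_mem_closure {s : Set k} [CompactSpace s] (t : s) {C π : k} (hC0 : C ≠ 0)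
    (hC : ∀ z ∈ s, ∀ w ∈ s, ‖z - w‖ ≤ ‖C‖) (h0 : 0 < ‖π‖) (h1 : ‖π‖ < 1)
    (hπ : ∀ x : k, ‖x‖ < 1 → ‖x‖ ≤ ‖π‖) (n : ℕ) :
    ∃ χ ∈ (polynomialFunctions s).topologicalClosure, ∀ z : s,
      (‖(z : k) - t‖ ≤ ‖C * π ^ n‖ → χ z = 1) ∧ (¬ ‖(z : k) - t‖ ≤ ‖C * π ^ n‖ → χ z = 0) := by
  have := IsLocalField.complete (k := k)
  have hπ0 : π ≠ 0 := norm_pos_iff.mp h0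
  obtain ⟨N, hN0, hN⟩ := exists_pow_eq_one k
  induction n with
  | zero =>
    refine ⟨1, one_mem _, fun z => ⟨fun _ => rfl, fun h => absurd ?_ h⟩⟩
    simpa using hC z z.2 t t.2
  | succ n ih =>
    obtain ⟨χ, hχ, hχz⟩ := ih
    set c : k := C * π ^ n with hc
    have hc0 : c ≠ 0 := mul_ne_zero hC0 (pow_ne_zero _ hπ0)
    have hc0' : 0 < ‖c‖ := norm_pos_iff.mpr hc0
    have hcs : ‖C * π ^ (n + 1)‖ = ‖c‖ * ‖π‖ := by rw [← norm_mul, hc, mul_assoc, pow_succ]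
    let g : C(s, k) := χ * (c⁻¹ • (⟨fun z => (z : k), continuous_subtype_val⟩ - algebraMap k _ t))
    have hz : (⟨fun z => (z : k), continuous_subtype_val⟩ : C(s, k)) ∈
        (polynomialFunctions s).topologicalClosure := by
      refine Subalgebra.le_topologicalClosure _ ⟨Polynomial.X, trivial, ?_⟩
      ext z
      change Polynomial.toContinuousMapOnAlgHom s Polynomial.X z = z
      simp
    have hgm : g ∈ (polynomialFunctions s).topologicalClosure :=
      mul_mem hχ (Subalgebra.smul_mem _ (sub_mem hz (Subalgebra.algebraMap_mem _ _)) _)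
    have hgz : ∀ z, g z = χ z * (c⁻¹ * (z - t)) := fun z => rfl
    have hg1 : ∀ z : s, ‖(z : k) - t‖ ≤ ‖c‖ → ‖g z‖ = ‖c‖⁻¹ * ‖(z : k) - t‖ := fun z h => by
      rw [hgz, (hχz z).1 h, one_mul, norm_mul, norm_inv]
    have hg0 : ∀ z : s, ¬ ‖(z : k) - t‖ ≤ ‖c‖ → g z = 0 := fun z h => by
      rw [hgz, (hχz z).2 h, zero_mul]
    have hgle : ∀ z, ‖g z‖ ≤ 1 := fun z => by
      by_cases h : ‖(z : k) - t‖ ≤ ‖c‖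
      · rw [hg1 z h]
        exact (inv_mul_le_one₀ hc0').mpr h
      · simp [hg0 z h]
    -- Close to 1 where `‖g z‖ < 1` (the smaller ball) and close to 0 where `‖g z‖ = 1`, hence
    -- idempotent modulo the open unit ball. Off the larger ball `g` vanishes and `f` is 1, which is
    -- why the final witness carries the factor `χ`.
    let f : C(s, k) := 1 - g ^ N
    have hfz : ∀ z, f z = 1 - g z ^ N := fun z => rfl
    have hpow : ∀ z, ‖g z ^ N‖ ≤ 1 := fun z => by
      rw [norm_pow]
      exact pow_le_one₀ (norm_nonneg _) (hgle z)
    have hf1 : ‖f‖ ≤ 1 := (ContinuousMap.norm_le _ zero_le_one).mpr fun z => by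
      rw [hfz]
      exact (norm_sub_le_max' _ _).trans (max_le norm_one.le (hpow z))
    have hlt : ∀ z, ‖g z‖ < 1 → ‖1 - f z‖ < 1 := fun z h => by
      rw [hfz, sub_sub_cancel, norm_pow]
      exact pow_lt_one₀ (norm_nonneg _) h hN0
    have heq : ∀ z, ‖g z‖ = 1 → ‖f z‖ < 1 := fun z h => norm_sub_pow_lt_one hN h
    have hff : ‖f * f - f‖ < 1 := by
      refine (ContinuousMap.norm_lt_iff _ zero_lt_one).mpr fun z => ?_
      change ‖f z * f z - f z‖ < 1
      rw [show f z * f z - f z = -(f z * (1 - f z)) by ring, norm_neg, norm_mul]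
      have h1 : ‖f z‖ ≤ 1 := (f.norm_coe_le_norm z).trans hf1
      have h2 : ‖1 - f z‖ ≤ 1 := by
        rw [hfz, sub_sub_cancel]
        exact hpow z
      rcases (hgle z).lt_or_eq with h | h
      · exact mul_lt_one_of_nonneg_of_lt_one_right h1 (norm_nonneg _) (hlt z h)
      · exact mul_lt_one_of_nonneg_of_lt_one_left (norm_nonneg _) (heq z h) h2
    have : Nonempty s := ⟨t⟩
    obtain ⟨e, he, hef, hmem⟩ := exists_isIdempotentElem_norm_sub_lt hf1 hff
    have hem : e ∈ (polynomialFunctions s).topologicalClosure :=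
      hmem (polynomialFunctions s).topologicalClosure.toSubring
        (Subalgebra.isClosed_topologicalClosure _) (sub_mem (one_mem _) (pow_mem hgm N))
    have hez : ∀ z, e z = 0 ∨ e z = 1 := fun z => by
      have h1 : e z * e z = e z := congrArg (fun u : C(s, k) => u z) he
      exact IsIdempotentElem.iff_eq_zero_or_one.mp h1
    have hefz : ∀ z, ‖e z - f z‖ < 1 := fun z => ((e - f).norm_coe_le_norm z).trans_lt hef
    refine ⟨χ * e, mul_mem hχ hem, fun z => ⟨fun h => ?_, fun h => ?_⟩⟩
    · rw [hcs] at h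
      have hlt' : ‖(z : k) - t‖ < ‖c‖ := h.trans_lt (mul_lt_of_lt_one_right hc0' h1)
      have h2 : ‖g z‖ < 1 := by
        rw [hg1 z hlt'.le]
        exact (inv_mul_lt_one₀ hc0').mpr hlt'
      change χ z * e z = 1
      rw [(hχz z).1 hlt'.le, one_mul]
      refine (hez z).resolve_left fun h3 => ?_
      have h4 := hefz z
      rw [h3, zero_sub, norm_neg] at h4
      have h5 := norm_lt_of_norm_sub_lt (hlt z h2) h4
      simp at h5
    · change χ z * e z = 0
      by_cases h' : ‖(z : k) - t‖ ≤ ‖c‖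
      · have h1 : ‖g z‖ = 1 := by
          refine le_antisymm (hgle z) (not_lt.mp fun hlt => h ?_)
          have := hπ _ hlt
          rw [hg1 z h', inv_mul_le_iff₀ hc0'] at this
          rwa [hcs]
        rcases hez z with h2 | h2
        · rw [h2, mul_zero]
        · have h3 := norm_lt_of_norm_sub_lt (hefz z) (heq z h1)
          simp [h2] at h3
      · rw [(hχz z).2 h', zero_mul]

/-- Polynomial functions are dense in the continuous functions on a compact subset of a local
field. -/
theorem polynomialFunctions_topologicalClosure (s : Set k) [CompactSpace s] :
    (polynomialFunctions s).topologicalClosure = ⊤ := by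
  obtain ⟨π, h0, h1, hπ⟩ := exists_uniformizer k
  obtain ⟨r, hr⟩ := (isCompact_iff_compactSpace.mpr ‹CompactSpace s›).isBounded.exists_norm_le
  obtain ⟨C, hC0, hC⟩ := exists_norm_le_norm (k := k) r
  refine eq_top_iff.mpr fun f _ => ?_
  rw [← SetLike.mem_coe, ← IsClosed.closure_eq (Subalgebra.isClosed_topologicalClosure _)]
  refine Metric.mem_closure_iff.mpr fun ε hε => ?_
  obtain ⟨δ, hδ, hfδ⟩ := Metric.uniformContinuous_iff.mp
    (CompactSpace.uniformContinuous_of_continuous f.continuous) (ε / 2) (half_pos hε)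
  obtain ⟨n, hn⟩ := exists_pow_lt_of_lt_one
    (div_pos hδ (norm_pos_iff.mpr hC0)) h1
  have hn' : ‖C * π ^ n‖ < δ := by
    rw [norm_mul, norm_pow, mul_comm]
    exact (lt_div_iff₀ (norm_pos_iff.mpr hC0)).mp hn
  have hball := fun t : s => exists_indicator_mem_closure t hC0 (fun z hz w hw =>
    (norm_sub_le_max' z w).trans (max_le ((hr z hz).trans hC) ((hr w hw).trans hC))) h0 h1 hπ n
  choose χ hχ hχz using hball
  have hpos : 0 < ‖C * π ^ n‖ :=
    norm_pos_iff.mpr (mul_ne_zero hC0 (pow_ne_zero _ (norm_pos_iff.mp h0)))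
  have happrox : ∀ T : Finset s, ∃ m ∈ (polynomialFunctions s).topologicalClosure,
      ∀ t ∈ T, ∀ z : s, ‖(z : k) - t‖ ≤ ‖C * π ^ n‖ → dist (f z) (m z) ≤ ε / 2 := by
    intro T
    classical
    induction T using Finset.induction_on with
    | empty => exact ⟨0, zero_mem _, by simp⟩
    | insert t T _ ih =>
      obtain ⟨m, hm, hmT⟩ := ih
      -- Overwrites `m` by the constant `f t` on the ball around `t` and leaves it unchanged
      -- elsewhere, so overlapping balls do no harm.
      refine ⟨m + χ t * (algebraMap k _ (f t) - m), add_mem hm (mul_mem (hχ t)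
        (sub_mem (Subalgebra.algebraMap_mem _ _) hm)), fun u hu z hz => ?_⟩
      change dist (f z) (m z + χ t z * (f t - m z)) ≤ ε / 2
      by_cases h : ‖(z : k) - t‖ ≤ ‖C * π ^ n‖
      · rw [(hχz t z).1 h, one_mul, add_sub_cancel]
        refine (hfδ ?_).le
        rw [Subtype.dist_eq, dist_eq_norm]
        exact h.trans_lt hn'
      · rw [(hχz t z).2 h, zero_mul, add_zero]
        rcases Finset.mem_insert.mp hu with rfl | hu
        · exact absurd hz h
        · exact hmT u hu z hz
  obtain ⟨T, -, hT⟩ := isCompact_univ.elim_nhds_subcover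
    (fun t : s => Metric.closedBall t ‖C * π ^ n‖) fun t _ => Metric.closedBall_mem_nhds t hpos
  obtain ⟨m, hm, hmT⟩ := happrox T
  refine ⟨m, hm, lt_of_le_of_lt ((ContinuousMap.dist_le (half_pos hε).le).mpr fun z => ?_)
    (half_lt_self hε)⟩
  obtain ⟨t, ht, hzt⟩ := Set.mem_iUnion₂.mp (hT (Set.mem_univ z))
  refine hmT t ht z ?_
  rwa [Metric.mem_closedBall, Subtype.dist_eq, dist_eq_norm] at hzt

end Density

/-! ### From polynomials to continuous functions. -/

section Extension

variable {k : Type*} [NormedField k] [IsUltrametricDist k] [IsLocalField k]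
  {A : Type*} [NormedRing A] [NormedAlgebra k A] [CompleteSpace A]

/-- If evaluation at `a` is isometric for the supremum norm on polynomial functions on a compact
set, it extends to an isometric homomorphism on continuous functions. -/
theorem exists_isometric_algHom (s : Set k) [CompactSpace s] (a : A)
    (h : ∀ p : Polynomial k, ‖Polynomial.aeval a p‖ = ‖Polynomial.toContinuousMapOnAlgHom s p‖) :
    ∃ ι : C(s, k) →ₐ[k] A,
      (∀ f, ‖ι f‖ = ‖f‖) ∧ ι ⟨fun z => (z : k), continuous_subtype_val⟩ = a := by
  have := IsLocalField.complete (k := k)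
  -- The closure of the graph of the two evaluations. Its projection to `C(s, k)` is isometric with
  -- closed and dense range, hence bijective, and `ι` is its inverse followed by the projection to
  -- `A`.
  let Γ : Subalgebra k (A × C(s, k)) :=
    ((Polynomial.aeval a).prod (Polynomial.toContinuousMapOnAlgHom s)).range.topologicalClosure
  have hΓ : ∀ x ∈ Γ, ‖x.1‖ = ‖x.2‖ := by
    intro x hx
    have hcl : IsClosed {x : A × C(s, k) | ‖x.1‖ = ‖x.2‖} :=
      isClosed_eq continuous_fst.norm continuous_snd.norm
    refine closure_minimal ?_ hcl hx
    rintro _ ⟨p, rfl⟩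
    exact h p
  have hΓc : IsComplete (Γ : Set (A × C(s, k))) :=
    (Subalgebra.isClosed_topologicalClosure _).isComplete
  let pr : Γ →ₐ[k] C(s, k) := (AlgHom.snd k A C(s, k)).comp Γ.val
  have hiso : Isometry pr := by
    refine AddMonoidHomClass.isometry_of_norm pr fun x => ?_
    change ‖(x : A × C(s, k)).2‖ = ‖(x : A × C(s, k))‖
    rw [Prod.norm_def, hΓ x x.2, max_self]
  have hclosed : IsClosed (Set.range pr) := by
    have : CompleteSpace Γ := hΓc.completeSpace_coe
    exact hiso.isClosedEmbedding.isClosed_range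
  have hsurj : Function.Surjective pr := by
    intro f
    have hf : f ∈ closure (polynomialFunctions s : Set C(s, k)) := by
      have : f ∈ (polynomialFunctions s).topologicalClosure := by
        rw [polynomialFunctions_topologicalClosure]
        trivial
      exact this
    refine closure_minimal ?_ hclosed hf
    rintro _ ⟨p, -, rfl⟩
    exact ⟨⟨_, Subalgebra.le_topologicalClosure _ ⟨p, rfl⟩⟩, rfl⟩
  let e : Γ ≃ₐ[k] C(s, k) := AlgEquiv.ofBijective pr ⟨hiso.injective, hsurj⟩
  refine ⟨((AlgHom.fst k A C(s, k)).comp Γ.val).comp e.symm.toAlgHom, fun f => ?_, ?_⟩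
  · obtain ⟨x, rfl⟩ := e.surjective f
    change ‖((e.symm (e x) : Γ) : A × C(s, k)).1‖ = ‖(x : A × C(s, k)).2‖
    rw [e.symm_apply_apply]
    exact hΓ x x.2
  · let x : Γ := ⟨_, Subalgebra.le_topologicalClosure _ ⟨Polynomial.X, rfl⟩⟩
    have hx : e x = ⟨fun z => (z : k), continuous_subtype_val⟩ := by
      ext z
      change Polynomial.toContinuousMapOnAlgHom s Polynomial.X z = z
      simp
    rw [← hx]
    change ((e.symm (e x) : Γ) : A × C(s, k)).1 = a
    rw [e.symm_apply_apply]
    change Polynomial.aeval a Polynomial.X = a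
    simp

end Extension

/-! ### Reduction of an isometric homomorphism from `C(X, k)`. -/

section IsometricCalculus

variable {X : Type*} [TopologicalSpace X] [CompactSpace X] [Nonempty X]
  {k : Type*} [NormedField k] [IsUltrametricDist k]

/-- Evaluation at a point, followed by reduction. -/
noncomputable def evalReduction (x : X) : unitBall C(X, k) →+* NormalReduction k :=
  (Ideal.Quotient.mk (openUnitIdeal k)).comp
    { toFun := fun u => ⟨(u : C(X, k)) x, ((u : C(X, k)).norm_coe_le_norm x).trans u.2⟩
      map_one' := rfl
      map_mul' := fun _ _ => rfl
      map_zero' := rfl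
      map_add' := fun _ _ => rfl }

theorem evalReduction_eq_iff {x y : X} {u v : unitBall C(X, k)} :
    evalReduction x u = evalReduction y v ↔ ‖(u : C(X, k)) x - (v : C(X, k)) y‖ < 1 :=
  mk_eq_mk_iff

theorem isLocallyConstant_evalReduction (u : unitBall C(X, k)) :
    IsLocallyConstant fun x => evalReduction x u := by
  refine IsLocallyConstant.iff_eventually_eq _ |>.mpr fun x => ?_
  have h : Tendsto (u : C(X, k)) (𝓝 x) (𝓝 ((u : C(X, k)) x)) :=
    (u : C(X, k)).continuous.tendsto x
  filter_upwards [Metric.tendsto_nhds.mp h 1 zero_lt_one] with y hy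
  rw [evalReduction_eq_iff, ← dist_eq_norm]
  exact hy

theorem exists_evalReduction_eq {φ : X → NormalReduction k} (hφ : IsLocallyConstant φ) :
    ∃ u : unitBall C(X, k), ∀ x, evalReduction x u = φ x := by
  let f : X → unitBall k := fun x => Quotient.out (φ x)
  have hf : Continuous fun x => (f x : k) :=
    (hφ.comp fun L => ((Quotient.out L : unitBall k) : k)).continuous
  refine ⟨⟨⟨fun x => (f x : k), hf⟩, ?_⟩, fun x => ?_⟩
  · exact (ContinuousMap.norm_le _ zero_le_one).mpr fun x => (f x).2
  · exact Ideal.Quotient.mk_out (φ x)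

variable {A : Type*} [NormedRing A] [NormOneClass A] [IsUltrametricDist A] [NormedAlgebra k A]
  (ι : C(X, k) →ₐ[k] A) (hι : ∀ f, ‖ι f‖ = ‖f‖)

/-- The reduction of an isometric homomorphism `C(X, k) → A`, as a map on the unit ball. -/
noncomputable def calculusReduction : unitBall C(X, k) →+* NormalReduction A :=
  (Ideal.Quotient.mk (openUnitIdeal A)).comp
    ((ι.toRingHom.comp (unitBall C(X, k)).subtype).codRestrict (unitBall A) fun u =>
      (hι u).le.trans u.2)

/-- By compactness a function has supremum norm below 1 as soon as all its values do. So identities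
and injectivity in the reduction of `A` can be checked pointwise on `X`. -/
theorem calculusReduction_eq_iff {u v : unitBall C(X, k)} :
    calculusReduction ι hι u = calculusReduction ι hι v ↔
      ∀ x, evalReduction x u = evalReduction x v := by
  refine mk_eq_mk_iff.trans ?_
  change ‖ι u - ι v‖ < 1 ↔ _
  rw [← map_sub, hι, ContinuousMap.norm_lt_iff _ zero_lt_one]
  exact forall_congr' fun x => evalReduction_eq_iff.symm

theorem algebraMap_eq_calculusReduction {L : NormalReduction k} {u : unitBall C(X, k)}
    (hu : ∀ x, evalReduction x u = L) :
    algebraMap (NormalReduction k) (NormalReduction A) L = calculusReduction ι hι u := by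
  obtain ⟨a, rfl⟩ := Ideal.Quotient.mk_surjective L
  have h : calculusReduction ι hι (unitBallMap k C(X, k) a) = calculusReduction ι hι u :=
    (calculusReduction_eq_iff ι hι).mpr fun x => (hu x).symm ▸ rfl
  rw [← h]
  exact congrArg _ (Subtype.ext (ι.commutes (a : k)).symm)

theorem mem_spectrum_calculusReduction_iff {u : unitBall C(X, k)} {L : NormalReduction k} :
    L ∈ spectrum (NormalReduction k) (calculusReduction ι hι u) ↔ ∃ x, evalReduction x u = L := by
  obtain ⟨l, hl⟩ := exists_evalReduction_eq (X := X) (IsLocallyConstant.const L)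
  rw [spectrum.mem_iff, algebraMap_eq_calculusReduction ι hι hl, ← map_sub]
  constructor
  · intro h
    by_contra! hne
    refine h ?_
    -- The pointwise inverse of the reduced `l - u`, which vanishes nowhere.
    obtain ⟨w, hw⟩ := exists_evalReduction_eq
      ((isLocallyConstant_evalReduction (l - u)).comp Ring.inverse)
    have h1 : calculusReduction ι hι ((l - u) * w) = 1 := by
      rw [← map_one (calculusReduction ι hι), calculusReduction_eq_iff]
      intro x
      rw [map_mul, hw, map_one]
      refine Ring.mul_inverse_cancel _ (isUnit_of_ne_zero k (L := evalReduction x (l - u)) ?_)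
      rw [map_sub, hl]
      exact sub_ne_zero.mpr (hne x).symm
    have h2 : calculusReduction ι hι (w * (l - u)) = 1 := by
      rwa [mul_comm]
    rw [map_mul] at h1 h2
    exact ⟨⟨_, _, h1, h2⟩, rfl⟩
  · rintro ⟨x, rfl⟩ hunit
    classical
    -- The indicator of the fibre through `x`: nonzero, but it annihilates `l - u`.
    obtain ⟨w, hw⟩ := exists_evalReduction_eq
      ((isLocallyConstant_evalReduction u).comp
        fun M => if M = evalReduction x u then (1 : NormalReduction k) else 0)
    have h1 : calculusReduction ι hι (w * (l - u)) = 0 := by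
      rw [← map_zero (calculusReduction ι hι), calculusReduction_eq_iff]
      intro y
      rw [map_mul, map_sub, hl, hw, map_zero, Function.comp_apply]
      split_ifs with h
      · rw [h, Function.const_apply, sub_self, mul_zero]
      · rw [zero_mul]
    rw [map_mul, hunit.mul_left_eq_zero, ← map_zero (calculusReduction ι hι),
      calculusReduction_eq_iff] at h1
    have h2 := h1 x
    rw [hw, map_zero, Function.comp_apply, if_pos rfl] at h2
    exact one_ne_zero h2

/-- Send `h` to the reduction of a lift of `h` composed with the reduced function `u`. This is
injective because the spectrum is exactly the set of values of that function. -/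
theorem exists_isReductiveCalculus (u : unitBall C(X, k)) :
    ∃ φ, IsReductiveCalculus k (calculusReduction ι hι u) φ := by
  classical
  set S := spectrum (NormalReduction k) (calculusReduction ι hι u) with hS
  let ext' : (S → NormalReduction k) → NormalReduction k → NormalReduction k :=
    fun h L => if hL : L ∈ S then h ⟨L, hL⟩ else 0
  have hmem : ∀ x, evalReduction x u ∈ S := fun x =>
    (mem_spectrum_calculusReduction_iff ι hι).mpr ⟨x, rfl⟩
  have hex := fun h => exists_evalReduction_eq
    ((isLocallyConstant_evalReduction u).comp (ext' h))
  choose lift hlift using hex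
  have hl : ∀ h x, evalReduction x (lift h) = h ⟨evalReduction x u, hmem x⟩ := fun h x => by
    rw [hlift, Function.comp_apply]
    exact dif_pos (hmem x)
  let φ : (S → NormalReduction k) →ₐ[NormalReduction k] NormalReduction A :=
    { toFun := fun h => calculusReduction ι hι (lift h)
      map_one' := by
        rw [← map_one (calculusReduction ι hι), calculusReduction_eq_iff]
        intro x
        rw [hl, map_one, Pi.one_apply]
      map_mul' := fun g h => by
        rw [← map_mul, calculusReduction_eq_iff]
        intro x
        rw [hl, map_mul, hl, hl, Pi.mul_apply]
      map_zero' := by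
        rw [← map_zero (calculusReduction ι hι), calculusReduction_eq_iff]
        intro x
        rw [hl, map_zero, Pi.zero_apply]
      map_add' := fun g h => by
        rw [← map_add, calculusReduction_eq_iff]
        intro x
        rw [hl, map_add, hl, hl, Pi.add_apply]
      commutes' := fun L => by
        refine (algebraMap_eq_calculusReduction ι hι fun x => ?_).symm
        rw [hl]
        rfl }
  refine ⟨φ, fun g h hgh => funext fun L => ?_, ?_⟩
  · obtain ⟨x, hx⟩ := (mem_spectrum_calculusReduction_iff ι hι).mp L.2
    have h1 := (calculusReduction_eq_iff ι hι).mp hgh x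
    rw [hl, hl] at h1
    have h2 : (⟨evalReduction x u, hmem x⟩ : S) = L := Subtype.ext hx
    rwa [h2] at h1
  · refine (calculusReduction_eq_iff ι hι).mpr fun x => ?_
    rw [hl]

end IsometricCalculus

/-! ### Elements in the range of an isometric homomorphism are naive. -/

section IsometricNaive

variable {X : Type*} [TopologicalSpace X] [CompactSpace X]
  {k : Type*} [NormedField k] [IsUltrametricDist k]
  {A : Type*} [NormedRing A] [NormedAlgebra k A]

/-- Were `f x - ι f` invertible, the indicator `χ` of a small clopen set around `x` would satisfy `ι
χ = ι (χ * (f x - f)) * v⁻¹`, of norm below 1, although `χ x = 1`. -/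
theorem apply_mem_spectrum_of_isometric (ι : C(X, k) →ₐ[k] A) (hι : ∀ f, ‖ι f‖ = ‖f‖)
    (f : C(X, k)) (x : X) : f x ∈ spectrum k (ι f) := by
  rw [spectrum.mem_iff]
  rintro ⟨v, hv⟩
  obtain ⟨ε, hε, hε1⟩ : ∃ ε > 0, ε * ‖(↑v⁻¹ : A)‖ < 1 := by
    refine ⟨(‖(↑v⁻¹ : A)‖ + 1)⁻¹, by positivity, ?_⟩
    rw [inv_mul_lt_one₀ (by positivity)]
    exact lt_add_one _
  classical
  have hclopen : IsClopen {y : X | ‖f y - f x‖ < ε} := by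
    have h := (IsUltrametricDist.isClopen_ball (f x) ε).preimage f.continuous
    convert h using 1
    ext y
    simp [dist_eq_norm]
  let χ : C(X, k) := ⟨Set.indicator {y : X | ‖f y - f x‖ < ε} 1,
    LocallyConstant.coe_charFn k hclopen ▸ (LocallyConstant.charFn k hclopen).continuous⟩
  have h1 : χ x = 1 := Set.indicator_of_mem (by simpa using hε) _
  have h2 : ‖χ * (algebraMap k _ (f x) - f)‖ ≤ ε := by
    refine (ContinuousMap.norm_le _ hε.le).mpr fun y => ?_
    change ‖Set.indicator {y : X | ‖f y - f x‖ < ε} 1 y * (f x - f y)‖ ≤ ε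
    rw [Set.indicator_apply]
    split_ifs with h
    · rw [Pi.one_apply, one_mul, norm_sub_rev]
      exact h.le
    · simpa using hε.le
  have h3 : ι χ = ι (χ * (algebraMap k _ (f x) - f)) * ↑v⁻¹ := by
    rw [map_mul, map_sub, AlgHom.commutes, ← hv, mul_assoc, Units.mul_inv, mul_one]
  have h4 : 1 ≤ ‖χ‖ := by
    have := χ.norm_coe_le_norm x
    rwa [h1, norm_one] at this
  rw [← hι, h3] at h4
  refine absurd (h4.trans (norm_mul_le _ _)) (not_le.mpr ?_)
  rw [hι]
  exact (mul_le_mul_of_nonneg_right h2 (norm_nonneg _)).trans_lt hε1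

variable [NormOneClass A] [IsUltrametricDist A] [IsLocalField k]

theorem exists_step_eq_of_isometric (ι : C(X, k) →ₐ[k] A) (hι : ∀ f, ‖ι f‖ = ‖f‖)
    (f : C(X, k)) : ∃ g, ι g = step k (ι f) := by
  have := IsLocalField.complete (k := k)
  have hcl : IsClosed (ι.range : Set A) := by
    have h : Isometry ι := AddMonoidHomClass.isometry_of_norm ι hι
    exact h.isClosedEmbedding.isClosed_range
  have hp : projection k (ι f) ∈ ι.range := by
    unfold projection
    split_ifs with h
    · refine Subalgebra.topologicalClosure_minimal (Algebra.adjoin_le ?_) hcl h.2.choose_spec.2.1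
      rintro _ rfl
      exact ⟨f, rfl⟩
    · exact zero_mem _
  exact mul_mem hp ⟨f, rfl⟩

variable [Nonempty X]

theorem isNaiveZero_of_isometric (ι : C(X, k) →ₐ[k] A) (hι : ∀ f, ‖ι f‖ = ‖f‖)
    (hnorm : ∀ b : A, ∃ c : k, ‖c‖ = ‖b‖) (f : C(X, k)) :
    IsNaiveZero k (ι f) := by
  rcases eq_or_ne (ι f) 0 with h0 | h0
  · exact Or.inl h0
  refine Or.inr ?_
  have key : ∀ (c : k) (h : IsScale k (ι f) c), ∃ u : unitBall C(X, k),
      (u : C(X, k)) = c⁻¹ • f ∧ scaledReduction h = calculusReduction ι hι u := by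
    intro c h
    have hu : ‖c⁻¹ • f‖ ≤ 1 := by
      rw [← hι, map_smul]
      exact h.norm_inv_smul_le
    exact ⟨⟨c⁻¹ • f, hu⟩, rfl, congrArg (Ideal.Quotient.mk (openUnitIdeal A))
      (Subtype.ext (map_smul ι c⁻¹ f).symm)⟩
  obtain ⟨c, hc⟩ := hnorm (ι f)
  have hcs : IsScale k (ι f) c := ⟨norm_ne_zero_iff.mp (hc ▸ norm_ne_zero_iff.mpr h0), hc⟩
  have := IsLocalField.finite_residue (k := k)
  refine ⟨⟨c, hcs, Set.toFinite _⟩, ⟨c, hcs, ?_⟩, fun c h L hL => ?_⟩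
  · obtain ⟨u, -, hu⟩ := key c hcs
    rw [hu]
    exact exists_isReductiveCalculus ι hι u
  · obtain ⟨u, huf, hu⟩ := key c h
    rw [hu, mem_spectrum_calculusReduction_iff] at hL
    obtain ⟨x, hx⟩ := hL
    refine ⟨(u : C(X, k)) x, ?_, _, hx⟩
    rw [← map_smul, ← huf]
    exact apply_mem_spectrum_of_isometric ι hι _ x

/-- The step leaves the translates of the coordinate function but not the range of `ι`, so the
induction runs over all `f`. -/
theorem isNaiveLevel_of_isometric (ι : C(X, k) →ₐ[k] A) (hι : ∀ f, ‖ι f‖ = ‖f‖)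
    (hnorm : ∀ b : A, ∃ c : k, ‖c‖ = ‖b‖) (i : ℕ) (f : C(X, k)) :
    IsNaiveLevel k i (ι f) := by
  induction i generalizing f with
  | zero => exact isNaiveZero_of_isometric ι hι hnorm f
  | succ i ih =>
    refine ⟨isNaiveZero_of_isometric ι hι hnorm f, ?_⟩
    obtain ⟨g, hg⟩ := exists_step_eq_of_isometric ι hι f
    rw [← hg]
    exact ih g

end IsometricNaive

section Forward

variable {k : Type*} [NormedField k] [IsUltrametricDist k] [IsLocalField k]
  {A : Type*} [NormedRing A] [NormOneClass A] [IsUltrametricDist A] [NormedAlgebra k A]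
  [CompleteSpace A]

theorem HasContinuousCalculus.nonempty_and_isNaive (hnorm : ∀ b : A, ∃ c : k, ‖c‖ = ‖b‖) {a : A}
    (h : HasContinuousCalculus k a) : (spectrum k a).Nonempty ∧ IsNaive k a := by
  obtain ⟨ι, hι, ha⟩ := h
  have hne : (spectrum k a).Nonempty := by
    by_contra hempty
    -- On an empty spectrum `C(∅, k)` is the zero ring, so isometry would force `‖1‖ = 0` in `A`.
    rw [Set.not_nonempty_iff_eq_empty] at hempty
    have : IsEmpty (spectrum k a) := Set.isEmpty_coe_sort.mpr hempty
    have h1 := hι 1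
    rw [Subsingleton.elim (1 : C(spectrum k a, k)) 0, norm_zero,
      Subsingleton.elim (0 : C(spectrum k a, k)) 1, map_one, norm_one] at h1
    exact one_ne_zero h1
  refine ⟨hne, fun μ _ i => ?_⟩
  have : Nonempty (spectrum k a) := hne.to_subtype
  have h1 := isNaiveLevel_of_isometric ι hι hnorm i
    (⟨fun z => (z : k), continuous_subtype_val⟩ - algebraMap k _ μ)
  rwa [map_sub, ha, AlgHom.commutes] at h1

end Forward

/-! ### Idempotents supplied by the reductive calculus. -/

section ReductiveCalculus

variable {k : Type*} [NormedField k] [IsUltrametricDist k]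
  {A : Type*} [NormedRing A] [NormOneClass A] [IsUltrametricDist A] [NormedAlgebra k A]
  {b : A} {c : k} {h : IsScale k b c}
  {ι : (spectrum (NormalReduction k) (scaledReduction h) → NormalReduction k) →ₐ[NormalReduction k]
      NormalReduction A}

open Classical in
theorem IsReductiveCalculus.apply_indicator_zero (hι : IsReductiveCalculus k (scaledReduction h) ι)
    {N : ℕ} (hN0 : N ≠ 0) (hN : ∀ L : NormalReduction k, L ≠ 0 → L ^ N = 1) :
    ι (fun L => if (L : NormalReduction k) = 0 then 1 else 0) = 1 - scaledReduction h ^ N := by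
  have h1 : (fun L : spectrum (NormalReduction k) (scaledReduction h) =>
      if (L : NormalReduction k) = 0 then (1 : NormalReduction k) else 0) =
      1 - (fun L : spectrum (NormalReduction k) (scaledReduction h) =>
        (L : NormalReduction k)) ^ N := by
    funext L
    rw [Pi.sub_apply, Pi.one_apply, Pi.pow_apply]
    split_ifs with h
    · rw [h, zero_pow hN0, sub_zero]
    · rw [hN _ h, sub_self]
  rw [h1, map_sub, map_one, map_pow, hι.2]

open Classical in
theorem IsReductiveCalculus.reduce_eq_iff (hι : IsReductiveCalculus k (scaledReduction h) ι)
    {N : ℕ} (hN0 : N ≠ 0) (hN : ∀ L : NormalReduction k, L ≠ 0 → L ^ N = 1) {p : A}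
    (hp : ‖p‖ ≤ 1) :
    reduce p hp = ι (fun L => if (L : NormalReduction k) = 0 then 1 else 0) ↔
      ‖p - (1 - (c⁻¹ • b) ^ N)‖ < 1 := by
  rw [hι.apply_indicator_zero hN0 hN]
  let x : unitBall A := ⟨c⁻¹ • b, h.norm_inv_smul_le⟩
  have h1 : Ideal.Quotient.mk (openUnitIdeal A) (1 - x ^ N) = 1 - scaledReduction h ^ N := by
    rw [map_sub, map_one, map_pow]
    rfl
  rw [← h1]
  exact mk_eq_mk_iff (x := ⟨p, hp⟩) (y := 1 - x ^ N)

open Classical in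
theorem IsReductiveCalculus.norm_mul_lt_one (hι : IsReductiveCalculus k (scaledReduction h) ι)
    {p : A} (hp : ‖p‖ ≤ 1)
    (hpι : reduce p hp = ι (fun L => if (L : NormalReduction k) = 0 then 1 else 0)) :
    ‖p * c⁻¹ • b‖ < 1 := by
  refine (mk_eq_zero_iff (x := (⟨p, hp⟩ * ⟨c⁻¹ • b, h.norm_inv_smul_le⟩ : unitBall A))).mp ?_
  rw [map_mul]
  change reduce p hp * scaledReduction h = 0
  refine (congrArg (fun y => reduce p hp * y) hι.2.symm).trans ?_
  rw [hpι, ← map_mul, ← map_zero ι]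
  congr 1
  funext L
  rw [Pi.mul_apply, Pi.zero_apply, ite_mul, one_mul, zero_mul]
  split_ifs with h
  · exact h
  · rfl

/-- Lifts to `A` of the images of the primitive idempotents under the reductive calculus. -/
theorem IsReductiveCalculus.exists_lift_single
    (hι : IsReductiveCalculus k (scaledReduction h) ι)
    [Fintype (spectrum (NormalReduction k) (scaledReduction h))] :
    ∃ d : spectrum (NormalReduction k) (scaledReduction h) → A, ‖1 - ∑ L, d L‖ < 1 ∧
      ∀ (L : spectrum (NormalReduction k) (scaledReduction h)) (ν : k) (hν : ‖ν‖ ≤ 1),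
        reduce ν hν = (L : NormalReduction k) →
        ‖(c⁻¹ • b - algebraMap k A ν) * d L‖ < 1 := by
  classical
  -- Arbitrary lifts suffice: they need be neither idempotent nor in the closure of `k[b]`.
  choose d hd using fun L => Ideal.Quotient.mk_surjective (ι (Pi.single L 1))
  refine ⟨fun L => (d L : A), ?_, fun L ν hν hL => ?_⟩
  · have h1 : Ideal.Quotient.mk (openUnitIdeal A) (1 - ∑ L, d L) = 0 := by
      rw [map_sub, map_sum, map_one, sub_eq_zero, Finset.sum_congr rfl fun L _ => hd L, ← map_sum,
        ← map_one ι, eq_comm]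
      congr 1
      exact (Finset.univ_sum_single (1 : spectrum (NormalReduction k) (scaledReduction h) →
        NormalReduction k))
    have h2 := mk_eq_zero_iff.mp h1
    simpa using h2
  · let x : unitBall A := ⟨c⁻¹ • b, h.norm_inv_smul_le⟩
    refine (mk_eq_zero_iff (x := (x - unitBallMap k A ⟨ν, hν⟩) * d L)).mp ?_
    rw [map_mul, map_sub, hd]
    change (scaledReduction h - algebraMap (NormalReduction k) (NormalReduction A) (reduce ν hν)) *
      _ = 0
    refine (congrArg (fun y => (y - algebraMap _ _ (reduce ν hν)) * ι (Pi.single L 1))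
      hι.2.symm).trans ?_
    rw [← ι.commutes, ← map_sub, ← map_mul, ← map_zero ι]
    congr 1
    funext M
    rw [Pi.mul_apply, Pi.sub_apply, Pi.zero_apply, Pi.algebraMap_apply, hL]
    rcases eq_or_ne M L with rfl | hne
    · change ((M : NormalReduction k) - M) * _ = 0
      rw [sub_self, zero_mul]
    · rw [Pi.single_eq_of_ne hne, mul_zero]

variable [IsLocalField k] [CompleteSpace A]

/-- Newton's iteration started at `1 - (c⁻¹ • b) ^ N`, whose reduction is the image of the indicator
of `0`. -/
theorem HasReductiveCalculus.exists_isLiftedProjection {b : A} (hb : HasReductiveCalculus k b) :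
    ∃ p, IsLiftedProjection k b p := by
  classical
  obtain ⟨c, h, ι, hι⟩ := hb
  obtain ⟨N, hN0, hN⟩ := exists_pow_eq_one k
  set x := c⁻¹ • b with hx
  have hx1 : x ∈ unitBall A := h.norm_inv_smul_le
  have hf1 : 1 - x ^ N ∈ unitBall A := sub_mem (one_mem _) (pow_mem hx1 N)
  let x' : unitBall A := ⟨x, hx1⟩
  have hff : ‖(1 - x ^ N) * (1 - x ^ N) - (1 - x ^ N)‖ < 1 := by
    refine (mk_eq_mk_iff (x := (1 - x' ^ N) * (1 - x' ^ N)) (y := 1 - x' ^ N)).mp ?_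
    rw [map_mul, map_sub, map_one, map_pow]
    change (1 - scaledReduction h ^ N) * (1 - scaledReduction h ^ N) = 1 - scaledReduction h ^ N
    rw [← hι.apply_indicator_zero hN0 hN, ← map_mul]
    congr 1
    funext L
    rw [Pi.mul_apply]
    split_ifs
    · exact one_mul 1
    · exact zero_mul 0
  obtain ⟨e, he, hef, hmem⟩ := exists_isIdempotentElem_norm_sub_lt hf1 hff
  have he1 : ‖e‖ ≤ 1 := norm_le_of_norm_sub_le hef.le hf1
  have h1 : e ∈ Algebra.elemental k b :=
    hmem (Algebra.elemental k b).toSubring (Algebra.elemental.isClosed k b)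
      (sub_mem (one_mem _) (pow_mem (Subalgebra.smul_mem _ (Algebra.elemental.self_mem k b) _) N))
  have h2 := (hι.reduce_eq_iff hN0 hN he1).mpr hef
  exact ⟨e, he, h1, he1, c, h, ι, hι, h2⟩

/-- Only these defining properties of the chosen projection enter the argument, never its
uniqueness. -/
theorem isLiftedProjection_projection {b : A} (hb : HasReductiveCalculus k b) (h0 : b ≠ 0) :
    IsLiftedProjection k b (projection k b) := by
  unfold projection
  rw [dif_pos ⟨h0, hb.exists_isLiftedProjection⟩]
  exact Exists.choose_spec _

end ReductiveCalculus

section ClosedSubalgebra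

variable {k : Type*} [NormedField k] {A : Type*} [NormedRing A] [NormedAlgebra k A]

theorem mul_comm_of_mem_closure {a x y : A} (hx : x ∈ (Algebra.adjoin k {a}).topologicalClosure)
    (hy : y ∈ (Algebra.adjoin k {a}).topologicalClosure) : x * y = y * x := by
  exact congrArg Subtype.val
    (mul_comm (⟨x, hx⟩ : Algebra.elemental k a) (⟨y, hy⟩ : Algebra.elemental k a))

end ClosedSubalgebra

/-! ### Spectral projections, their refinement and covering. -/

section SpectralProjection

variable {k : Type*} [NormedField k] {A : Type*} [NormedRing A] [NormedAlgebra k A]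

/-- The idempotent `e` of the closed algebra generated by `a` cuts out a part on which `a - l` has
norm at most `r`, and `a - l` is bounded below by `r'` on the complement. -/
structure IsSpectralProjection (a : A) (l : k) (r r' : ℝ) (e : A) : Prop where
  isIdempotentElem : IsIdempotentElem e
  mem : e ∈ (Algebra.adjoin k {a}).topologicalClosure
  norm_le : ‖e‖ ≤ 1
  norm_mul_sub_le : ‖e * (a - algebraMap k A l)‖ ≤ r
  le_norm_mul : ∀ y, e * y = 0 → r' * ‖y‖ ≤ ‖(a - algebraMap k A l) * y‖

/-- An inverse of `l + μ - a`, cut down by `e`, together with `μ⁻¹` on the complement of `e`, would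
invert `μ - e * (a - l)`. This needs `μ ≠ 0`; for `μ = 0` the hypothesis on `l` is the claim. -/
theorem add_mem_spectrum {a e : A} {l μ : k} (he : IsIdempotentElem e) (hea : Commute e a)
    (hl : l ∈ spectrum k a) (hμ : μ ∈ spectrum k (e * (a - algebraMap k A l))) :
    l + μ ∈ spectrum k a := by
  rcases eq_or_ne μ 0 with rfl | hμ0
  · rwa [add_zero]
  rw [spectrum.mem_iff] at hμ ⊢
  contrapose! hμ
  obtain ⟨v, hv⟩ := hμ
  have hev : Commute e (v : A) := by
    rw [hv]
    exact Commute.sub_right (Algebra.commutes (l + μ) e).symm hea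
  have hew : Commute e (↑v⁻¹ : A) := hev.units_inv_right
  have hee : e * e = e := he
  have h1 : algebraMap k A μ - e * (a - algebraMap k A l) =
      e * v + algebraMap k A μ * (1 - e) := by
    rw [hv, map_add, mul_sub, mul_sub, mul_sub, mul_add, mul_one, ← Algebra.commutes μ e]
    abel
  have hμe : Commute (algebraMap k A μ) e := Algebra.commutes μ e
  have hμe' : Commute (algebraMap k A μ⁻¹) e := Algebra.commutes μ⁻¹ e
  have hμμ : algebraMap k A μ * algebraMap k A μ⁻¹ = 1 := by
    rw [← map_mul, mul_inv_cancel₀ hμ0, map_one]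
  have hμμ' : algebraMap k A μ⁻¹ * algebraMap k A μ = 1 := by
    rw [← map_mul, inv_mul_cancel₀ hμ0, map_one]
  have aux : ∀ {x y m n : A}, Commute e x → Commute e y → Commute m e → Commute n e →
      x * y = 1 → m * n = 1 → (e * x + m * (1 - e)) * (e * y + n * (1 - e)) = 1 := by
    intro x y m n hx hy hm hn hxy hmn
    have e1 : e * x * (e * y) = e := by
      rw [hx.eq, mul_assoc, ← mul_assoc e e y, hee, hy.eq, ← mul_assoc, hxy, one_mul]
    have e2 : e * x * (n * (1 - e)) = 0 := by
      rw [mul_sub, mul_one, hn.eq, hx.eq, mul_sub, mul_assoc x e n, mul_assoc x e (e * n),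
        ← mul_assoc e e n, hee, sub_self]
    have e3 : m * (1 - e) * (e * y) = 0 := by
      rw [mul_assoc, ← mul_assoc (1 - e) e y, sub_mul, one_mul, hee, sub_self, zero_mul, mul_zero]
    have e4 : m * (1 - e) * (n * (1 - e)) = 1 - e := by
      have h5 : Commute (1 - e) n := ((Commute.one_left n).sub_left hn.symm)
      have h6 : (1 - e) * (1 - e) = 1 - e := he.one_sub
      rw [mul_assoc, ← mul_assoc (1 - e) n, h5.eq, mul_assoc n, h6, ← mul_assoc, hmn, one_mul]
    rw [add_mul, mul_add, mul_add, e1, e2, e3, e4]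
    abel
  rw [h1]
  exact ⟨⟨_, e * ↑v⁻¹ + algebraMap k A μ⁻¹ * (1 - e),
    aux hev hew hμe hμe' v.mul_inv hμμ, aux hew hev hμe' hμe v.inv_mul hμμ'⟩, rfl⟩

variable [IsUltrametricDist k] [NormOneClass A] [IsUltrametricDist A] [IsLocalField k]

/-- After one step, the part cut out by a spectral projection is exhausted by the refined
projections at the points of the spectrum. -/
theorem IsSpectralProjection.norm_mul_le_of_refinement {a e u : A} {l c : k} {r r' K : ℝ}
    (he : IsSpectralProjection a l ‖c‖ r' e) (hl : l ∈ spectrum k a) (hc0 : c ≠ 0)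
    (hnaive : ∀ i, IsNaiveLevel k i (e * (a - algebraMap k A l)))
    (heq : ‖e * (a - algebraMap k A l)‖ = ‖c‖) {e' : spectrum k a → A}
    (he' : ∀ t : spectrum k a, IsSpectralProjection a (t : k) r ‖c‖ (e' t)) (hK : 0 ≤ K)
    (hu : ∀ t, ‖e' t * u‖ ≤ K) : ‖e * u‖ ≤ K := by
  classical
  have hc0' : 0 < ‖c‖ := norm_pos_iff.mpr hc0
  set b := a - algebraMap k A l with hb
  have hB0 : e * b ≠ 0 := norm_pos_iff.mp (heq ▸ hc0')
  set M := (Algebra.adjoin k {a}).topologicalClosure with hM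
  have haM : a ∈ M := Subalgebra.le_topologicalClosure _ (Algebra.subset_adjoin rfl)
  have hbM : b ∈ M := sub_mem haM (Subalgebra.algebraMap_mem _ _)
  have hee : e * e = e := he.isIdempotentElem
  obtain ⟨-, ⟨d, hd, ι, hι⟩, hlifts⟩ := (hnaive 0 : IsNaiveZero k (e * b)).resolve_left hB0
  have hdc : ‖d‖ = ‖c‖ := hd.2.trans heq
  -- Each reduced spectral value lifts to a spectral value `ν L`, and `l + d * ν L` is then a point
  -- of the spectrum of `a`.
  choose ν hν hν1 hνL using fun L : spectrum (NormalReduction k) (scaledReduction hd) =>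
    hlifts d hd L L.2
  have := IsLocalField.finite_residue (k := k)
  have := Fintype.ofFinite (spectrum (NormalReduction k) (scaledReduction hd))
  obtain ⟨s, hs1, hs⟩ := hι.exists_lift_single
  have ht : ∀ L, l + d * ν L ∈ spectrum k a := fun L => by
    refine add_mem_spectrum he.isIdempotentElem (mul_comm_of_mem_closure he.mem haM) hl ?_
    have h1 := (spectrum.smul_mem_smul_iff (r := Units.mk0 d hd.1)).mpr (hν L)
    rwa [Units.smul_mk0, Units.smul_mk0, smul_inv_smul₀ hd.1] at h1
  let t : spectrum (NormalReduction k) (scaledReduction hd) → spectrum k a :=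
    fun L => ⟨l + d * ν L, ht L⟩
  -- The lower bound off `e' (t L)` gives `‖c‖ * ‖g * s L‖ ≤ ‖(a - t L) * (g * s L)‖`, which is
  -- below `‖c‖ * ‖g‖` because `s L` nearly kills `d⁻¹ • (e * b) - ν L`. So every `g * s L` is
  -- smaller than `g`, while their sum is close to `g`.
  have hvanish : ∀ g ∈ M, e * g = g → (∀ L, e' (t L) * g = 0) → g = 0 := by
    intro g hgM heg hg
    by_contra hg0
    have hg0' : 0 < ‖g‖ := norm_pos_iff.mpr hg0
    have h1 : ∀ L, ‖g * s L‖ < ‖g‖ := by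
      intro L
      have h2 : (a - algebraMap k A (t L)) * (g * s L) =
          d • (g * ((d⁻¹ • (e * b) - algebraMap k A (ν L)) * s L)) := by
        have h3 : g * (d⁻¹ • (e * b)) = d⁻¹ • (b * g) := by
          rw [mul_smul_comm, ← mul_assoc, mul_comm_of_mem_closure hgM he.mem, heg,
            mul_comm_of_mem_closure hgM hbM]
        have h4 : a - algebraMap k A (t L) = b - d • algebraMap k A (ν L) := by
          change a - algebraMap k A (l + d * ν L) = _
          rw [map_add, map_mul, hb, Algebra.smul_def]
          abel
        rw [← mul_assoc g, mul_sub, h3, h4, ← mul_assoc, ← smul_mul_assoc, smul_sub,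
          smul_inv_smul₀ hd.1, sub_mul, smul_mul_assoc, Algebra.commutes]
      have h3 := (he' (t L)).le_norm_mul (g * s L) (by rw [← mul_assoc, hg, zero_mul])
      rw [h2, norm_smul, hdc] at h3
      exact (le_of_mul_le_mul_left h3 hc0').trans_lt ((norm_mul_le _ _).trans_lt
        (mul_lt_of_lt_one_right hg0' (hs L (ν L) (hν1 L) (hνL L))))
    have h2 : ‖∑ L, g * s L‖ < ‖g‖ := by
      refine Finset.sum_induction _ (fun y => ‖y‖ < ‖g‖) (fun y z hy hz => ?_) ?_ fun L _ => h1 L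
      · exact (IsUltrametricDist.norm_add_le_max y z).trans_lt (max_lt hy hz)
      · simpa using hg0'
    have h3 : ‖g - ∑ L, g * s L‖ < ‖g‖ := by
      rw [← Finset.mul_sum]
      have h4 : g - g * ∑ L, s L = g * (1 - ∑ L, s L) := by rw [mul_sub g, mul_one]
      rw [h4]
      exact (norm_mul_le _ _).trans_lt (mul_lt_of_lt_one_right hg0' hs1)
    exact lt_irrefl _ (norm_lt_of_norm_sub_lt h3 h2)
  -- Here `g` is `e` times the product of the `1 - e' (t L)` over `T`; each factor changes `g * u`
  -- by at most `K`.
  have hkill : ∀ T : Finset (spectrum (NormalReduction k) (scaledReduction hd)),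
      ∃ g ∈ M, ‖g‖ ≤ 1 ∧ e * g = g ∧ (∀ L ∈ T, e' (t L) * g = 0) ∧ ‖e * u - g * u‖ ≤ K := by
    intro T
    induction T using Finset.induction_on with
    | empty => exact ⟨e, he.mem, he.norm_le, hee, by simp, by simpa using hK⟩
    | insert L T _ ih =>
      obtain ⟨g, hgM, hg1, heg, hgT, hgu⟩ := ih
      have hp := he' (t L)
      refine ⟨g - e' (t L) * g, sub_mem hgM (mul_mem hp.mem hgM), ?_, ?_, fun L' hL' => ?_, ?_⟩
      · exact (norm_sub_le_max' _ _).trans (max_le hg1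
          ((norm_mul_le _ _).trans (mul_le_one₀ hp.norm_le (norm_nonneg _) hg1)))
      · rw [mul_sub, ← mul_assoc, mul_comm_of_mem_closure he.mem hp.mem, mul_assoc, heg]
      · rcases Finset.mem_insert.mp hL' with rfl | hL'
        · rw [mul_sub, ← mul_assoc, hp.isIdempotentElem.eq, sub_self]
        · rw [mul_sub, ← mul_assoc, mul_comm_of_mem_closure (he' (t L')).mem hp.mem, mul_assoc,
            hgT L' hL', mul_zero, sub_zero]
      · have h1 : e * u - (g - e' (t L) * g) * u = (e * u - g * u) + g * (e' (t L) * u) := by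
          rw [sub_mul, mul_comm_of_mem_closure hp.mem hgM, mul_assoc]
          abel
        rw [h1]
        refine (IsUltrametricDist.norm_add_le_max _ _).trans (max_le hgu ?_)
        exact (norm_mul_le _ _).trans
          ((mul_le_of_le_one_left (norm_nonneg _) hg1).trans (hu (t L)))
  obtain ⟨g, hgM, -, heg, hgT, hgu⟩ := hkill Finset.univ
  rw [hvanish g hgM heg fun L => hgT L (Finset.mem_univ _)] at hgu
  simpa using hgu

variable [CompleteSpace A]

theorem projection_spec {b : A} (h0 : b ≠ 0) (hb : IsNaiveZero k b) :
    IsIdempotentElem (projection k b) ∧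
      projection k b ∈ (Algebra.adjoin k {b}).topologicalClosure ∧ ‖projection k b‖ ≤ 1 ∧
      ∃ c : k, IsScale k b c ∧ ‖projection k b * c⁻¹ • b‖ < 1 ∧
        ∃ m : ℕ, ‖projection k b - (1 - (c⁻¹ • b) ^ (m + 1))‖ < 1 := by
  obtain ⟨N, hN0, hN⟩ := exists_pow_eq_one k
  obtain ⟨m, rfl⟩ := Nat.exists_eq_succ_of_ne_zero hN0
  obtain ⟨h1, h2, h3, c, h, ι, hι, hp⟩ :=
    isLiftedProjection_projection (hb.resolve_left h0).2.1 h0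
  exact ⟨h1, h2, h3, c, h, hι.norm_mul_lt_one h3 hp, m, (hι.reduce_eq_iff hN0 hN h3).mp hp⟩

/-- One step of the process refines a spectral projection. -/
theorem IsSpectralProjection.exists_refinement {a e : A} {l c π : k} {r' : ℝ}
    (he : IsSpectralProjection a l ‖c‖ r' e) (hc0 : c ≠ 0) (hr : ‖c‖ ≤ r')
    (hnaive : ∀ i, IsNaiveLevel k i (e * (a - algebraMap k A l)))
    (hπ : ∀ b : A, ‖b‖ < ‖c‖ → ‖b‖ ≤ ‖c‖ * ‖π‖) :
    ∃ e', IsSpectralProjection a l (‖c‖ * ‖π‖) ‖c‖ e' ∧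
      (∀ i, IsNaiveLevel k i (e' * (a - algebraMap k A l))) ∧
      (e' = e ∨ ‖e * (a - algebraMap k A l)‖ = ‖c‖) := by
  have hc0' : 0 < ‖c‖ := norm_pos_iff.mpr hc0
  -- If the norm is already below the scale, discreteness makes it at most the next scale and `e` is
  -- kept. Otherwise `e` is cut down by the projection of `e * b`, so `e' * b` is `step k (e * b)`
  -- and one level of naivety is spent.
  rcases he.norm_mul_sub_le.lt_or_eq with hlt | heq
  · exact ⟨e, ⟨he.isIdempotentElem, he.mem, he.norm_le, hπ _ hlt, fun y hy =>
      (mul_le_mul_of_nonneg_right hr (norm_nonneg _)).trans (he.le_norm_mul y hy)⟩, hnaive,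
      Or.inl rfl⟩
  set b := a - algebraMap k A l with hb
  have hB0 : e * b ≠ 0 := norm_pos_iff.mp (heq ▸ hc0')
  obtain ⟨hpi, hpm, hp1, d, hd, hpd, m, hm⟩ := projection_spec (k := k) hB0 (hnaive 0)
  set p := projection k (e * b) with hp
  set M := (Algebra.adjoin k {a}).topologicalClosure with hM
  have hdc : ‖d‖ = ‖c‖ := hd.2.trans heq
  have haM : a ∈ M := Subalgebra.le_topologicalClosure _ (Algebra.subset_adjoin rfl)
  have hbM : b ∈ M := sub_mem haM (Subalgebra.algebraMap_mem _ _)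
  have hpM : p ∈ M := by
    refine Subalgebra.topologicalClosure_minimal (Algebra.adjoin_le ?_)
      (Subalgebra.isClosed_topologicalClosure _) hpm
    rintro _ rfl
    exact mul_mem he.mem hbM
  have hpe : p * e = e * p := mul_comm_of_mem_closure hpM he.mem
  have heb : e * b = b * e := mul_comm_of_mem_closure he.mem hbM
  have hee : e * e = e := he.isIdempotentElem
  refine ⟨p * e, ⟨?_, mul_mem hpM he.mem, ?_, ?_, fun y hy => ?_⟩, fun i => ?_, Or.inr heq⟩
  · exact hpi.mul_of_commute hpe he.isIdempotentElem
  · exact (norm_mul_le _ _).trans (mul_le_one₀ hp1 (norm_nonneg _) he.norm_le)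
  · refine hπ _ ?_
    rw [mul_smul_comm, norm_smul, norm_inv, hdc, inv_mul_lt_one₀ hc0'] at hpd
    rwa [mul_assoc]
  · have h1e : ‖1 - e‖ ≤ 1 := (norm_sub_le_max' _ _).trans (max_le norm_one.le he.norm_le)
    have h1 : ‖c‖ * ‖y - e * y‖ ≤ ‖b * y‖ := by
      have h2 : e * (y - e * y) = 0 := by rw [mul_sub, ← mul_assoc, hee, sub_self]
      have h3 : b * (y - e * y) = (1 - e) * (b * y) := by
        rw [mul_sub, sub_mul 1 e, one_mul, ← mul_assoc, ← mul_assoc, heb]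
      calc ‖c‖ * ‖y - e * y‖ ≤ r' * ‖y - e * y‖ := by gcongr
        _ ≤ ‖b * (y - e * y)‖ := he.le_norm_mul _ h2
        _ ≤ ‖1 - e‖ * ‖b * y‖ := h3 ▸ norm_mul_le _ _
        _ ≤ ‖b * y‖ := mul_le_of_le_one_left (norm_nonneg _) h1e
    have h2 : ‖c‖ * ‖e * y‖ ≤ ‖b * y‖ := by
      set w := e * y with hw
      rcases eq_or_ne w 0 with hw0 | hw0
      · rw [hw0, norm_zero, mul_zero]
        exact norm_nonneg _
      have hw0' : 0 < ‖w‖ := norm_pos_iff.mpr hw0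
      have hpw : p * w = 0 := by rw [hw, ← mul_assoc, hy]
      set x := d⁻¹ • (e * b) with hx
      have hx1 : x ∈ unitBall A := hd.norm_inv_smul_le
      -- Since `p * w = 0` and `p` is close to `1 - x ^ (m + 1)`, the power nearly fixes `w`. The
      -- exponent is positive, so one factor `x` can be split off to get `‖w‖ ≤ ‖x * w‖`.
      have h3 : ‖w - x ^ (m + 1) * w‖ < ‖w‖ := by
        have h4 : w - x ^ (m + 1) * w = -((p - (1 - x ^ (m + 1))) * w) := by
          rw [sub_mul, sub_mul, hpw, one_mul]
          abel
        rw [h4, norm_neg]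
        exact (norm_mul_le _ _).trans_lt (mul_lt_of_lt_one_left hw0' hm)
      have h5 : ‖w‖ ≤ ‖x ^ (m + 1) * w‖ := by
        by_contra! hcon
        exact lt_irrefl _ (norm_lt_of_norm_sub_lt h3 hcon)
      have h6 : ‖w‖ ≤ ‖x * w‖ := by
        rw [pow_succ, mul_assoc] at h5
        exact h5.trans ((norm_mul_le _ _).trans
          (mul_le_of_le_one_left (norm_nonneg _) (pow_mem hx1 m : x ^ m ∈ unitBall A)))
      have h7 : x * w = d⁻¹ • (e * (b * y)) := by
        rw [hx, hw, smul_mul_assoc, heb, mul_assoc, ← mul_assoc e e y, hee, ← mul_assoc b e y,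
          ← heb, mul_assoc]
      rw [h7, norm_smul, norm_inv, hdc, le_inv_mul_iff₀ hc0'] at h6
      exact h6.trans ((norm_mul_le _ _).trans (mul_le_of_le_one_left (norm_nonneg _) he.norm_le))
    have h3 : ‖y‖ ≤ ‖b * y‖ / ‖c‖ := by
      refine norm_le_of_norm_sub_le (y := e * y) ?_ ?_
      · rwa [le_div_iff₀ hc0', mul_comm]
      · rwa [le_div_iff₀ hc0', mul_comm]
    rwa [le_div_iff₀ hc0', mul_comm] at h3
  · have h1 := (hnaive (i + 1)).2
    rwa [step, ← hp, ← mul_assoc] at h1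

end SpectralProjection

/-! ### Naive elements have the norm of their spectral values. -/

section Backward

variable {k : Type*} [NormedField k]
  {A : Type*} [NormedRing A] [NormOneClass A] [NormedAlgebra k A] [CompleteSpace A]

theorem norm_eval_le_norm_aeval {a : A} {t : k} (ht : t ∈ spectrum k a) (p : Polynomial k) :
    ‖p.eval t‖ ≤ ‖Polynomial.aeval a p‖ :=
  spectrum.norm_le_norm_of_mem (spectrum.subset_polynomial_aeval a p ⟨t, ht, rfl⟩)

/-- `X - t` divides `p - p(t)`, with quotient bounded at `a` uniformly over the bounded spectrum.
That `D` depends on neither `t` nor `e` lets the scale tend to zero afterwards. -/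
theorem exists_norm_mul_aeval_sub_le (a : A) (p : Polynomial k) :
    ∃ D : ℝ, 0 ≤ D ∧ ∀ t ∈ spectrum k a, ∀ e : A,
      ‖e * (Polynomial.aeval a p - algebraMap k A (p.eval t))‖ ≤
        D * ‖e * (a - algebraMap k A t)‖ := by
  induction p using Polynomial.induction_on with
  | C x => exact ⟨0, le_rfl, fun t _ e => by simp⟩
  | add p q hp hq =>
    obtain ⟨D₁, hD₁, h₁⟩ := hp
    obtain ⟨D₂, hD₂, h₂⟩ := hq
    refine ⟨D₁ + D₂, add_nonneg hD₁ hD₂, fun t ht e => ?_⟩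
    rw [map_add, Polynomial.eval_add, map_add, add_sub_add_comm, mul_add, add_mul]
    exact (norm_add_le _ _).trans (add_le_add (h₁ t ht e) (h₂ t ht e))
  | monomial n x ih =>
    obtain ⟨D, hD, h⟩ := ih
    set q : Polynomial k := Polynomial.C x * Polynomial.X ^ n with hq
    refine ⟨D * ‖a‖ + ‖Polynomial.aeval a q‖, by positivity, fun t ht e => ?_⟩
    have h1 : e * (Polynomial.aeval a (q * Polynomial.X) -
        algebraMap k A ((q * Polynomial.X).eval t)) =
        e * (Polynomial.aeval a q - algebraMap k A (q.eval t)) * a +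
          q.eval t • (e * (a - algebraMap k A t)) := by
      rw [map_mul (Polynomial.aeval a) q, Polynomial.aeval_X, Polynomial.eval_mul,
        Polynomial.eval_X, map_mul (algebraMap k A), ← mul_smul_comm, Algebra.smul_def,
        mul_assoc e, ← mul_add e, sub_mul, mul_sub (algebraMap k A _)]
      congr 1
      abel
    rw [pow_succ, ← mul_assoc, ← hq, h1, add_mul]
    refine (norm_add_le _ _).trans (add_le_add ?_ ?_)
    · calc _ ≤ ‖e * (Polynomial.aeval a q - algebraMap k A (q.eval t))‖ * ‖a‖ := norm_mul_le _ _
        _ ≤ D * ‖e * (a - algebraMap k A t)‖ * ‖a‖ := by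
          gcongr
          exact h t ht e
        _ = D * ‖a‖ * ‖e * (a - algebraMap k A t)‖ := by ring
    · rw [norm_smul]
      gcongr
      exact norm_eval_le_norm_aeval ht q

variable [IsUltrametricDist k] [IsUltrametricDist A] [IsLocalField k]

/-- At every scale, a naive element has spectral projections that together cover `A`. -/
theorem exists_spectralProjections (hnorm : ∀ b : A, ∃ c : k, ‖c‖ = ‖b‖) {a : A}
    (hne : (spectrum k a).Nonempty) (ha : IsNaive k a) {C π : k} (hC0 : C ≠ 0) (hC : ‖a‖ ≤ ‖C‖)
    (h0 : 0 < ‖π‖) (h1 : ‖π‖ < 1) (hπ : ∀ x : k, ‖x‖ < 1 → ‖x‖ ≤ ‖π‖) (n : ℕ) :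
    ∃ (r' : ℝ) (e : spectrum k a → A), ‖C * π ^ n‖ ≤ r' ∧
      (∀ t : spectrum k a, IsSpectralProjection a (t : k) ‖C * π ^ n‖ r' (e t) ∧
        ∀ i, IsNaiveLevel k i (e t * (a - algebraMap k A t))) ∧
      ∀ (u : A) (K : ℝ), 0 ≤ K → (∀ t, ‖e t * u‖ ≤ K) → ‖u‖ ≤ K := by
  induction n with
  | zero =>
    -- At the coarsest scale the unit works at every point: its complement is zero, and covering
    -- needs just one spectral point.
    refine ⟨‖C‖, fun _ => 1, by simp, fun t => ⟨⟨IsIdempotentElem.one, one_mem _, norm_one.le, ?_,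
      fun y hy => ?_⟩, fun i => ?_⟩, fun u K _ hu => ?_⟩
    · rw [one_mul, pow_zero, mul_one]
      refine (norm_sub_le_max' _ _).trans (max_le hC ?_)
      rw [norm_algebraMap']
      exact (spectrum.norm_le_norm_of_mem t.2).trans hC
    · rw [one_mul] at hy
      simp [hy]
    · rw [one_mul]
      exact ha t t.2 i
    · obtain ⟨t, ht⟩ := hne
      simpa using hu ⟨t, ht⟩
  | succ n ih =>
    obtain ⟨r', e, hr, he, hcov⟩ := ih
    set c := C * π ^ n with hc
    have hc0 : c ≠ 0 := mul_ne_zero hC0 (pow_ne_zero _ (norm_pos_iff.mp h0))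
    have hc0' : 0 < ‖c‖ := norm_pos_iff.mpr hc0
    have hcs : ‖C * π ^ (n + 1)‖ = ‖c‖ * ‖π‖ := by rw [← norm_mul, hc, mul_assoc, pow_succ]
    have hπA : ∀ b : A, ‖b‖ < ‖c‖ → ‖b‖ ≤ ‖c‖ * ‖π‖ := fun b hb => by
      obtain ⟨x, hx⟩ := hnorm b
      rw [← hx] at hb ⊢
      have := hπ (x / c) (by rwa [norm_div, div_lt_one hc0'])
      rwa [norm_div, div_le_iff₀ hc0', mul_comm] at this
    choose e' he' hnaive' hor using fun t =>
      (he t).1.exists_refinement hc0 hr (he t).2 hπA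
    refine ⟨‖c‖, e', ?_, fun t => ⟨hcs ▸ he' t, hnaive' t⟩,
      fun u K hK hu => hcov u K hK fun t => ?_⟩
    · rw [hcs]
      exact mul_le_of_le_one_right hc0'.le h1.le
    · rcases hor t with h | h
      · rw [← h]
        exact hu t
      · exact (he t).1.norm_mul_le_of_refinement t.2 hc0 (he t).2 h he' hK hu

theorem norm_aeval_eq_of_isNaive (hnorm : ∀ b : A, ∃ c : k, ‖c‖ = ‖b‖) {a : A}
    (hne : (spectrum k a).Nonempty) (ha : IsNaive k a) (p : Polynomial k) :
    ‖Polynomial.aeval a p‖ = ‖Polynomial.toContinuousMapOnAlgHom (spectrum k a) p‖ := by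
  have heval : ∀ t : spectrum k a,
      Polynomial.toContinuousMapOnAlgHom (spectrum k a) p t = p.eval (t : k) := fun t => rfl
  refine le_antisymm ?_ ((ContinuousMap.norm_le _ (norm_nonneg _)).mpr fun t =>
    norm_eval_le_norm_aeval t.2 p)
  obtain ⟨π, h0, h1, hπ⟩ := exists_uniformizer k
  obtain ⟨C, hC0, hC⟩ := exists_norm_le_norm (k := k) ‖a‖
  obtain ⟨D, hD, hDp⟩ := exists_norm_mul_aeval_sub_le (k := k) a p
  set q := Polynomial.toContinuousMapOnAlgHom (spectrum k a) p with hq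
  have hlim : Tendsto (fun n : ℕ => max ‖q‖ (D * ‖C * π ^ n‖)) atTop (𝓝 (max ‖q‖ (D * 0))) := by
    refine tendsto_const_nhds.max (tendsto_const_nhds.mul ?_)
    have h2 := (tendsto_pow_atTop_nhds_zero_of_lt_one (norm_nonneg π) h1).const_mul ‖C‖
    simpa [norm_mul, norm_pow] using h2
  rw [mul_zero, max_eq_left (norm_nonneg _)] at hlim
  refine ge_of_tendsto' hlim fun n => ?_
  obtain ⟨r', e, -, he, hcov⟩ := exists_spectralProjections hnorm hne ha hC0 hC h0 h1 hπ n
  refine hcov _ _ (le_max_of_le_left (norm_nonneg _)) fun t => ?_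
  refine norm_le_of_norm_sub_le (y := e t * algebraMap k A (p.eval (t : k))) ?_ ?_
  · rw [← mul_sub]
    exact le_max_of_le_right ((hDp t t.2 (e t)).trans
      (mul_le_mul_of_nonneg_left (he t).1.norm_mul_sub_le hD))
  · refine le_max_of_le_left ((norm_mul_le _ _).trans ?_)
    rw [norm_algebraMap', ← heval]
    exact (mul_le_of_le_one_left (norm_nonneg _) (he t).1.norm_le).trans (q.norm_coe_le_norm t)

theorem IsNaive.hasContinuousCalculus (hnorm : ∀ b : A, ∃ c : k, ‖c‖ = ‖b‖) {a : A}
    (hne : (spectrum k a).Nonempty) (ha : IsNaive k a) : HasContinuousCalculus k a :=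
  exists_isometric_algHom (spectrum k a) a (norm_aeval_eq_of_isNaive hnorm hne ha)

end Backward

end NaiveCalculus

theorem mainTheorem1 {k : Type*} [NormedField k] [IsUltrametricDist k]
    [NaiveCalculus.IsLocalField k]
    {𝒜 : Type*} [NormedRing 𝒜] [NormOneClass 𝒜] [IsUltrametricDist 𝒜] [NormedAlgebra k 𝒜]
    [CompleteSpace 𝒜] (hnorm : ∀ B : 𝒜, ∃ c : k, ‖c‖ = ‖B‖) (A : 𝒜) :
    NaiveCalculus.HasContinuousCalculus k A ↔
      (spectrum k A).Nonempty ∧ NaiveCalculus.IsNaive k A :=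
  ⟨fun h => h.nonempty_and_isNaive hnorm, fun h => h.2.hasContinuousCalculus hnorm h.1⟩
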